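/- Let $p_1,\dots,p_n\in\mathbb R^3$ be unit vectors and $h=(h_1,\dots,h_n)\in\mathbb R^n$ such that $$P=\{x\in\mathbb R^3 \mid \langle x,p_i\rangle\le h_i \text{ for all } i\}$$ is bounded, has non-empty interior, and none of the inequalities is redundant; thus $P$ is a convex polyhedron with outward unit normals $p_i$ and support numbers $h_i$. Let $T$ be a geodesic triangulation of $\mathbb S^2$ with vertices $p_1,\dots,p_n$ dual to $P$. That is, the dual subdivision of $\mathbb S^2$ joins $p_i$ and $p_j$ by the shortest great circle arc whenever the $i$-th and the $j$-th faces of $P$ share an edge; $T$ is this subdivision if it is a triangulation, and otherwise it is obtained from it by subdividing the non-triangular cells by arbitrary (non-crossing) diagonals. For an edge $ij$ of $T$ let $ijk$ and $ijl$ be the two triangles containing it, let $\lambda_{ij}$ be the spherical length of $ij$, and let $\alpha^{k}_{ij}$ denote the angle at the vertex $k$ of the spherical triangle $ijk$. Put $$c_{ij}=\frac{\tan\frac{\alpha_{jk}^i+\alpha_{ki}^j-\alpha_{ij}^k}{2}+\tan\frac{\alpha_{lj}^i+\alpha_{il}^j-\alpha_{ji}^l}{2}}{2\cos^2\frac{\lambda_{ij}}2},\qquad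 d_i=\sum_j c_{ij}\sin^2\frac{\lambda_{ij}}2,$$ with $c_{ij}=0$ if $ij$ is not an edge of $T$, and let $\langle u,v\rangle_d=\sum_i d_iu_iv_i$. If all $d_i\neq 0$, the discrete spherical Laplacian is $(\triangle_s u)_i=\frac1{d_i}\sum_j c_{ij}(u_j-u_i)$. If all $d_i\ne 0$, then the surface area of $P$ equals $$\tfrac12\,\langle h,\,2h+\triangle_s h\rangle_d .$$ Without any assumption on the $d_i$, the same holds with $\langle h,\triangle_s h\rangle_d$ read in the weak sense, that is, the surface area of $P$ equals $$\tfrac12\Bigl(2\langle h,h\rangle_d+\sum_i h_i\sum_j c_{ij}(h_j-h_i)\Bigr).$$ -/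

import Mathlib

open MeasureTheory

noncomputable section

/-- Euclidean three-space. -/
abbrev E3 : Type := EuclideanSpace ℝ (Fin 3)

/-! ### Convex polyhedra given by normals and support numbers -/

/-- The solution set `{x | ⟨x, p i⟩ ≤ h i for all i}`. -/
def polyhedron {n : ℕ} (p : Fin n → E3) (h : Fin n → ℝ) : Set E3 :=
  {x | ∀ i, inner ℝ x (p i) ≤ h i}

/-- The `i`-th face of the polyhedron: the points where the `i`-th inequality is an equality. -/
def polyFace {n : ℕ} (p : Fin n → E3) (h : Fin n → ℝ) (i : Fin n) : Set E3 :=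
  {x | x ∈ polyhedron p h ∧ inner ℝ x (p i) = h i}

/-- None of the inequalities `⟨x, p i⟩ ≤ h i` is redundant: for every `i` there is a point that
violates the `i`-th inequality and satisfies all the others. -/
def Nonredundant {n : ℕ} (p : Fin n → E3) (h : Fin n → ℝ) : Prop :=
  ∀ i, ∃ x : E3, (∀ j, j ≠ i → inner ℝ x (p j) ≤ h j) ∧ h i < inner ℝ x (p i)

/-- The area of the boundary of `K`. The measure `μHE[2]` is the two-dimensional Hausdorff measure,
normalized so as to agree with Lebesgue measure on Euclidean planes. -/
def surfaceArea (K : Set E3) : ℝ := (μHE[2] (frontier K)).toReal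

/-! ### Geodesic triangulations of the unit sphere -/

/-- The geodesic simplex with vertices `p i`, `i ∈ s`: the part of the unit sphere in the convex
cone spanned by these points. For two linearly independent points it is the shortest great circle
arc between them, for three linearly independent points it is a spherical triangle. -/
def sphSimplex {n : ℕ} (p : Fin n → E3) (s : Finset (Fin n)) : Set E3 :=
  {x | ‖x‖ = 1 ∧ ∃ a : Fin n → ℝ, (∀ i, 0 ≤ a i) ∧ x = ∑ i ∈ s, a i • p i}

/-- `T` is (the set of triangles of) a geodesic triangulation of the unit sphere whose vertices are
exactly the points `p i`. -/
structure IsSphereTriangulation {n : ℕ} (p : Fin n → E3) (T : Finset (Finset (Fin n))) :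
    Prop where
  /-- Every triangle has three vertices ... -/
  card_eq : ∀ t ∈ T, t.card = 3
  /-- ... which do not lie on a great circle. -/
  nondegenerate : ∀ t ∈ T, LinearIndependent ℝ (fun i : t => p i)
  /-- Every `p i` is a vertex of the triangulation. -/
  vertex : ∀ i, ∃ t ∈ T, i ∈ t
  /-- The surface is closed: every edge belongs to exactly two triangles. -/
  two_triangles : ∀ i j, i ≠ j → (∃ t ∈ T, i ∈ t ∧ j ∈ t) →
    (T.filter fun t => i ∈ t ∧ j ∈ t).card = 2
  /-- The triangles cover the sphere. -/
  cover : ∀ x : E3, ‖x‖ = 1 → ∃ t ∈ T, x ∈ sphSimplex p t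
  /-- Two triangles meet exactly in their common face. -/
  inter_eq : ∀ s ∈ T, ∀ t ∈ T, sphSimplex p s ∩ sphSimplex p t = sphSimplex p (s ∩ t)

/-- `T` is a geodesic triangulation of the unit sphere dual to the polyhedron `{⟨x, p i⟩ ≤ h i}`:
its vertices are the outward normals `p i`, and it is the dual subdivision of the sphere (whose arcs
join the normals of faces that share an edge, and whose cells correspond to the vertices of the
polyhedron), the cells of which are subdivided by arbitrary diagonals if they are not triangles. -/
structure IsDualTriangulation {n : ℕ} (p : Fin n → E3) (h : Fin n → ℝ)
    (T : Finset (Finset (Fin n))) : Prop extends IsSphereTriangulation p T where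
  /-- If the `i`-th and the `j`-th faces share an edge, then the dual arc is an edge of `T`. -/
  dual_edge : ∀ i j, i ≠ j → (polyFace p h i ∩ polyFace p h j).Nontrivial →
    ∃ t ∈ T, i ∈ t ∧ j ∈ t
  /-- Every triangle lies in a cell of the dual subdivision: the three corresponding faces of the
  polyhedron have a common vertex. -/
  in_cell : ∀ t ∈ T, ∃ v : E3, ∀ i ∈ t, v ∈ polyFace p h i

/-! ### The discrete spherical Laplacian -/

/-- The length `λ_ij` of the shortest great circle arc between `p i` and `p j`. -/
def edgeLen {n : ℕ} (p : Fin n → E3) (i j : Fin n) : ℝ :=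
  InnerProductGeometry.angle (p i) (p j)

/-- The angle at the vertex `a` of the spherical triangle `a b c`: the angle between the directions
at `a` (in the tangent plane) of the arcs from `a` to `b` and to `c`. -/
def sphAngle (a b c : E3) : ℝ :=
  InnerProductGeometry.angle (b - inner ℝ b a • a) (c - inner ℝ c a • a)

/-- The edge weight `c_ij`: the sum over the triangles `ijk` that contain the edge `ij` (there are
two of them) of `tan ((α_i + α_j - α_k) / 2)`, where `α` denotes the angles of the triangle `ijk`,
divided by `2 cos² (λ_ij / 2)`. It is zero if `ij` is not an edge. -/
def edgeWeight {n : ℕ} (p : Fin n → E3) (T : Finset (Finset (Fin n))) (i j : Fin n) : ℝ :=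
  (∑ k ∈ Finset.univ.filter (fun k => i ≠ j ∧ k ≠ i ∧ k ≠ j ∧ {i, j, k} ∈ T),
      Real.tan ((sphAngle (p i) (p j) (p k) + sphAngle (p j) (p k) (p i)
        - sphAngle (p k) (p i) (p j)) / 2))
    / (2 * Real.cos (edgeLen p i j / 2) ^ 2)

/-- The vertex weight `d_i = ∑ j, c_ij sin² (λ_ij / 2)`. -/
def vertexWeight {n : ℕ} (p : Fin n → E3) (T : Finset (Finset (Fin n))) (i : Fin n) : ℝ :=
  ∑ j, edgeWeight p T i j * Real.sin (edgeLen p i j / 2) ^ 2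

/-- The discrete spherical Laplacian; it makes sense if no vertex weight vanishes. -/
def sphLaplacian {n : ℕ} (p : Fin n → E3) (T : Finset (Finset (Fin n))) (u : Fin n → ℝ) :
    Fin n → ℝ :=
  fun i => 1 / vertexWeight p T i * ∑ j, edgeWeight p T i j * (u j - u i)

/-- The bilinear form `⟨u, v⟩_d = ∑ i, d_i u_i v_i`. -/
def dInner {n : ℕ} (d u v : Fin n → ℝ) : ℝ := ∑ i, d i * u i * v i

/-- The weak discrete spherical Laplacian, that is the bilinear form
`∑ i, v_i ∑ j, c_ij (u_j - u_i)`. It equals `⟨Δ_s u, v⟩_d` if no vertex weight vanishes, and makes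
sense in general. -/
def weakSphLaplacian {n : ℕ} (p : Fin n → E3) (T : Finset (Finset (Fin n)))
    (u v : Fin n → ℝ) : ℝ :=
  ∑ i, v i * ∑ j, edgeWeight p T i j * (u j - u i)

end

/-! Cut the boundary into its faces, and each face into triangles with apex a relative interior
point `o` and bases on its edges. Inside the plane of face i, the edge shared with face j lies at
distance (h_j - ⟨o, p_j⟩) / sin λ_ij from `o` and has length sin λ_ij times `edgeSum`. The sines
cancel, so the face has area ½ ∑_j (h_j - ⟨o, p_j⟩) `edgeSum` (`measure_polyFace_eq`). The area does
not depend on `o`, so this affine expression is constant on the plane of the face, and `o` may be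
replaced by h_i p_i even if that point lies outside the face (`toReal_measure_polyFace`).

The endpoints of the edge are the vertices dual to the two triangles of T at ij, which lie on
opposite sides of ij. The signed position of each endpoint is a rational expression in the Gram
matrix and |det| of its triangle, namely `edgeTerm`. A diagonal of a cell has coinciding endpoints
and contributes 0. The area is thus a sum over the flags of the triangles of T.

The quadratic form is such a sum too: spherical trigonometry makes each tangent a rational
expression of the same kind (`tan_half_sphAngle`), and half-angle formulas absorb the vertex weights
(`weight_form_eq_sum`). The two summands differ flag by flag, but agree after adding the six flags
of a triangle (`areaTerm_perm`). -/

noncomputable section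

/-! ### Vector algebra in three-space: determinants, cross products, Gram identities. -/

/-- The determinant of three vectors of Euclidean three-space. -/
def det3 (u v w : E3) : ℝ :=
  u 0 * (v 1 * w 2 - v 2 * w 1) - u 1 * (v 0 * w 2 - v 2 * w 0) + u 2 * (v 0 * w 1 - v 1 * w 0)

/-- The cross product on Euclidean three-space. -/
def cross3 (u v : E3) : E3 :=
  !₂[u 1 * v 2 - u 2 * v 1, u 2 * v 0 - u 0 * v 2, u 0 * v 1 - u 1 * v 0]

lemma inner_E3 (u v : E3) : inner ℝ u v = u 0 * v 0 + u 1 * v 1 + u 2 * v 2 := by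
  simp only [PiLp.inner_apply, Fin.sum_univ_three, RCLike.inner_apply, conj_trivial]
  ring

lemma det3_swap_right (u v w : E3) : det3 u w v = -det3 u v w := by
  simp only [det3]; ring

lemma det3_swap_left (u v w : E3) : det3 v u w = -det3 u v w := by
  simp only [det3]; ring

lemma det3_add_right (u v w x : E3) : det3 u v (w + x) = det3 u v w + det3 u v x := by
  simp only [det3, PiLp.add_apply]; ring

lemma det3_sub_right (u v w x : E3) : det3 u v (w - x) = det3 u v w - det3 u v x := by
  simp only [det3, PiLp.sub_apply]; ring

lemma det3_smul_right (r : ℝ) (u v w : E3) : det3 u v (r • w) = r * det3 u v w := by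
  simp only [det3, PiLp.smul_apply, smul_eq_mul]; ring

lemma det3_self_left (u v : E3) : det3 u v u = 0 := by
  simp only [det3]; ring

lemma det3_self_right (u v : E3) : det3 u v v = 0 := by
  simp only [det3]; ring

lemma inner_cross3 (u v w : E3) : inner ℝ (cross3 u v) w = det3 u v w := by
  simp only [inner_E3, cross3, det3]; simp; ring

/-- The product of two determinants is the determinant of the mixed Gram matrix. -/
lemma det3_mul_det3 (u v w x : E3) :
    det3 u v x * det3 u v w =
      (inner ℝ u u * inner ℝ v v - inner ℝ u v ^ 2) * inner ℝ x w
      - (inner ℝ v w * inner ℝ u u - inner ℝ u w * inner ℝ u v) * inner ℝ x v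
      - (inner ℝ u w * inner ℝ v v - inner ℝ v w * inner ℝ u v) * inner ℝ x u := by
  simp only [inner_E3, det3]; ring

/-- Cramer's rule. -/
lemma det3_smul_eq (u v w x : E3) :
    det3 u v w • x = det3 x v w • u + det3 u x w • v + det3 u v x • w := by
  ext i
  fin_cases i <;> simp [det3] <;> ring

lemma smul_eq_det3_smul_cross3 {u v w : E3} (hu : inner ℝ w u = 0) (hv : inner ℝ w v = 0) :
    (inner ℝ u u * inner ℝ v v - inner ℝ u v ^ 2) • w = det3 u v w • cross3 u v := by
  -- An identity for every w: its last two terms vanish when w is orthogonal to u and v. Keeping the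
  -- Gram factor on the left avoids dividing by it.
  have key : (inner ℝ u u * inner ℝ v v - inner ℝ u v ^ 2) • w = det3 u v w • cross3 u v
      + (inner ℝ v v * inner ℝ w u - inner ℝ u v * inner ℝ w v) • u
      + (inner ℝ u u * inner ℝ w v - inner ℝ u v * inner ℝ w u) • v := by
    ext i
    simp only [inner_E3, det3, cross3]
    fin_cases i <;> simp <;> ring
  rw [key, hu, hv]; simp

lemma det3_ne_zero_of_linearIndependent {u v w : E3} (hl : LinearIndependent ℝ ![u, v, w]) :
    det3 u v w ≠ 0 := by
  have hl' := hl.map' (WithLp.linearEquiv 2 ℝ (Fin 3 → ℝ)).toLinearMap (LinearEquiv.ker _)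
  have := (Matrix.linearIndependent_rows_iff_isUnit
    (A := Matrix.of ((WithLp.linearEquiv 2 ℝ (Fin 3 → ℝ)).toLinearMap ∘ ![u, v, w]))).1 hl'
  rw [Matrix.isUnit_iff_isUnit_det, isUnit_iff_ne_zero, Matrix.det_fin_three] at this
  intro h0
  apply this
  simp only [det3] at h0
  simp
  linarith

lemma det3_eq_zero_of_eq_smul_add {u v x : E3} {r s : ℝ} (hx : x = r • u + s • v) :
    det3 u v x = 0 := by
  rw [hx, det3_add_right, det3_smul_right, det3_smul_right, det3_self_left, det3_self_right]
  simp

lemma exists_unit_orthogonal (p : E3) : ∃ u : E3, ‖u‖ = 1 ∧ inner ℝ p u = 0 := by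
  have : ∃ u : E3, u ≠ 0 ∧ inner ℝ p u = 0 := by
    by_cases h0 : p 0 = 0
    · refine ⟨!₂[1, 0, 0], fun h => ?_, ?_⟩
      · simpa using congrArg (fun x : E3 => x 0) h
      · simp [inner_E3, h0]
    · refine ⟨!₂[-p 1, p 0, 0], fun h => h0 ?_, ?_⟩
      · simpa using congrArg (fun x : E3 => x 1) h
      · simp [inner_E3]; ring
  obtain ⟨u, hu, hp⟩ := this
  refine ⟨‖u‖⁻¹ • u, ?_, ?_⟩
  · rw [norm_smul, norm_inv, norm_norm, inv_mul_cancel₀ (norm_ne_zero_iff.2 hu)]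
  · rw [inner_smul_right, hp, mul_zero]

lemma inner_self_of_unit {u : E3} (hu : ‖u‖ = 1) : inner ℝ u u = (1 : ℝ) := by
  rw [real_inner_self_eq_norm_sq, hu, one_pow]

lemma det3_sq_of_unit {u v w : E3} (hu : ‖u‖ = 1) (hv : ‖v‖ = 1) (hw : ‖w‖ = 1) :
    det3 u v w ^ 2 = 1 + 2 * inner ℝ u v * inner ℝ u w * inner ℝ v w
      - inner ℝ u v ^ 2 - inner ℝ u w ^ 2 - inner ℝ v w ^ 2 := by
  have h := det3_mul_det3 u v w w
  rw [inner_self_of_unit hu, inner_self_of_unit hv, inner_self_of_unit hw,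
    real_inner_comm v w, real_inner_comm u w] at h
  rw [sq, h]; ring

/-- Equality in Cauchy–Schwarz would make u × v vanish by Lagrange's identity, and the determinant
with it. -/
lemma inner_sq_lt_one_of_det3_ne_zero {u v w : E3} (hu : ‖u‖ = 1) (hv : ‖v‖ = 1)
    (hd : det3 u v w ≠ 0) : (inner ℝ u v : ℝ) ^ 2 < 1 := by
  have h1 := abs_real_inner_le_norm u v
  rw [hu, hv, mul_one, abs_le] at h1
  refine lt_of_le_of_ne (by nlinarith) fun h => hd ?_
  have h3 := real_inner_self_eq_norm_sq (cross3 u v)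
  have h4 : inner ℝ (cross3 u v) (cross3 u v)
      = inner ℝ u u * inner ℝ v v - (inner ℝ u v : ℝ) ^ 2 := by
    simp only [inner_E3, cross3]; simp; ring
  rw [inner_self_of_unit hu, inner_self_of_unit hv, h] at h4
  have h5 : cross3 u v = 0 := inner_self_eq_zero.1 (h4.trans (by norm_num))
  rw [← inner_cross3, h5, inner_zero_left]

lemma det3_rotate (u v w : E3) : det3 v w u = det3 u v w := by
  simp only [det3]; ring

/-! ### Spherical trigonometry: the tangents in the edge weights. -/

/-- The sine of the spherical distance, in terms of the inner product. -/
def sinDist (u v : E3) : ℝ := Real.sqrt (1 - inner ℝ u v ^ 2)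

lemma sinDist_comm (u v : E3) : sinDist u v = sinDist v u := by
  rw [sinDist, sinDist, real_inner_comm]

lemma sinDist_pos {u v w : E3} (hu : ‖u‖ = 1) (hv : ‖v‖ = 1) (hd : det3 u v w ≠ 0) :
    0 < sinDist u v :=
  Real.sqrt_pos.2 (sub_pos.2 (inner_sq_lt_one_of_det3_ne_zero hu hv hd))

lemma sinDist_sq {u v w : E3} (hu : ‖u‖ = 1) (hv : ‖v‖ = 1) (hd : det3 u v w ≠ 0) :
    sinDist u v ^ 2 = 1 - inner ℝ u v ^ 2 :=
  Real.sq_sqrt (sub_pos.2 (inner_sq_lt_one_of_det3_ne_zero hu hv hd)).le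

lemma inner_tangent {u : E3} (hu : ‖u‖ = 1) (v w : E3) :
    inner ℝ (v - (inner ℝ v u : ℝ) • u) (w - (inner ℝ w u : ℝ) • u)
      = inner ℝ v w - inner ℝ u v * inner ℝ u w := by
  simp only [inner_sub_left, inner_sub_right, inner_smul_left, inner_smul_right,
    inner_self_of_unit hu, real_inner_comm u v, real_inner_comm u w, conj_trivial]
  ring

lemma norm_tangent {u v : E3} (hu : ‖u‖ = 1) (hv : ‖v‖ = 1) :
    ‖v - (inner ℝ v u : ℝ) • u‖ = sinDist u v := by
  rw [norm_eq_sqrt_real_inner, inner_tangent hu, inner_self_of_unit hv, sinDist, sq]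

lemma cos_sphAngle {u v w : E3} (hu : ‖u‖ = 1) (hv : ‖v‖ = 1) (hw : ‖w‖ = 1) :
    Real.cos (sphAngle u v w)
      = (inner ℝ v w - inner ℝ u v * inner ℝ u w) / (sinDist u v * sinDist u w) := by
  rw [sphAngle, InnerProductGeometry.cos_angle, inner_tangent hu, norm_tangent hu hv,
    norm_tangent hu hw]

/-- The sine times the two norms is the root of the Gram determinant of the tangent projections, and
that determinant equals `det3 u v w ^ 2`. -/
lemma sin_sphAngle {u v w : E3} (hu : ‖u‖ = 1) (hv : ‖v‖ = 1) (hw : ‖w‖ = 1)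
    (hd : det3 u v w ≠ 0) :
    Real.sin (sphAngle u v w) = |det3 u v w| / (sinDist u v * sinDist u w) := by
  have hd' : det3 u w v ≠ 0 := by rw [det3_swap_right]; exact neg_ne_zero.2 hd
  have h := InnerProductGeometry.sin_angle_mul_norm_mul_norm
    (v - (inner ℝ v u : ℝ) • u) (w - (inner ℝ w u : ℝ) • u)
  rw [inner_tangent hu, inner_tangent hu, inner_tangent hu, norm_tangent hu hv,
    norm_tangent hu hw, inner_self_of_unit hv, inner_self_of_unit hw] at h
  rw [sphAngle, eq_div_iff (mul_pos (sinDist_pos hu hv hd) (sinDist_pos hu hw hd')).ne', h,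
    ← Real.sqrt_sq_eq_abs, det3_sq_of_unit hu hv hw]
  congr 1; ring

/-- This form removes the half angle, so that only sines and cosines of full angles remain. If cos x
= 0, both sides are 0 by the convention for division by zero. -/
lemma tan_eq_sin_two_mul_div (x : ℝ) :
    Real.tan x = Real.sin (2 * x) / (1 + Real.cos (2 * x)) := by
  rw [Real.tan_eq_sin_div_cos, Real.sin_two_mul, Real.cos_two_mul]
  rcases eq_or_ne (Real.cos x) 0 with h | h
  · simp [h]
  · field_simp; ring

/-- Here a, b, c are the cosines of the sides vw, uw, uv, their sines are y, z, x, and D is |det|.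
With α, β, γ the angles at u, v, w, the quotient is sin(α+β-γ) / (1 + cos(α+β-γ)). Both parts have
the denominator (1+c)(1-a)(1-b), with numerators D(1+c-a-b) and D². -/
lemma tan_half_aux {a b c D x y z : ℝ} (hx : 0 < x) (hy : 0 < y) (hz : 0 < z) (hD : 0 < D)
    (qx : x ^ 2 = 1 - c ^ 2) (qy : y ^ 2 = 1 - a ^ 2) (qz : z ^ 2 = 1 - b ^ 2)
    (hD2 : D ^ 2 = 1 + 2 * c * b * a - c ^ 2 - b ^ 2 - a ^ 2) :
    ((D / (x * z) * ((b - a * c) / (y * x)) + (a - c * b) / (x * z) * (D / (y * x)))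
          * ((c - b * a) / (z * y))
        - ((a - c * b) / (x * z) * ((b - a * c) / (y * x)) - D / (x * z) * (D / (y * x)))
          * (D / (z * y)))
      / (1 + (((a - c * b) / (x * z) * ((b - a * c) / (y * x)) - D / (x * z) * (D / (y * x)))
          * ((c - b * a) / (z * y))
        + (D / (x * z) * ((b - a * c) / (y * x)) + (a - c * b) / (x * z) * (D / (y * x)))
          * (D / (z * y)))) = (1 + c - b - a) / D := by
  have pc : 0 < 1 - c ^ 2 := qx ▸ by positivity
  have pa : 0 < 1 - a ^ 2 := qy ▸ by positivity
  have pb : 0 < 1 - b ^ 2 := qz ▸ by positivity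
  have c1 : 0 < 1 + c := by nlinarith
  have a1 : 0 < 1 - a := by nlinarith
  have b1 : 0 < 1 - b := by nlinarith
  have hM : 0 < (1 + c) * (1 - a) * (1 - b) := by positivity
  have hS : (D / (x * z) * ((b - a * c) / (y * x)) + (a - c * b) / (x * z) * (D / (y * x)))
          * ((c - b * a) / (z * y))
        - ((a - c * b) / (x * z) * ((b - a * c) / (y * x)) - D / (x * z) * (D / (y * x)))
          * (D / (z * y)) = D * (1 + c - b - a) / ((1 + c) * (1 - a) * (1 - b)) := by
    have : (D / (x * z) * ((b - a * c) / (y * x)) + (a - c * b) / (x * z) * (D / (y * x)))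
          * ((c - b * a) / (z * y))
        - ((a - c * b) / (x * z) * ((b - a * c) / (y * x)) - D / (x * z) * (D / (y * x)))
          * (D / (z * y))
        = D * ((b - a * c) * (c - b * a) + (a - c * b) * (c - b * a) - (a - c * b) * (b - a * c)
          + D ^ 2) / (x ^ 2 * y ^ 2 * z ^ 2) := by
      field_simp; ring
    rw [this, qx, qy, qz, div_eq_div_iff (by positivity) hM.ne']
    linear_combination (D * (1 + c) * (1 - a) * (1 - b)) * hD2
  have hC : 1 + (((a - c * b) / (x * z) * ((b - a * c) / (y * x)) - D / (x * z) * (D / (y * x)))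
          * ((c - b * a) / (z * y))
        + (D / (x * z) * ((b - a * c) / (y * x)) + (a - c * b) / (x * z) * (D / (y * x)))
          * (D / (z * y))) = D ^ 2 / ((1 + c) * (1 - a) * (1 - b)) := by
    have : 1 + (((a - c * b) / (x * z) * ((b - a * c) / (y * x)) - D / (x * z) * (D / (y * x)))
          * ((c - b * a) / (z * y))
        + (D / (x * z) * ((b - a * c) / (y * x)) + (a - c * b) / (x * z) * (D / (y * x)))
          * (D / (z * y)))
        = (x ^ 2 * y ^ 2 * z ^ 2 + (a - c * b) * (b - a * c) * (c - b * a)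
          + D ^ 2 * ((b - a * c) + (a - c * b) - (c - b * a))) / (x ^ 2 * y ^ 2 * z ^ 2) := by
      field_simp; ring
    rw [this, qx, qy, qz, div_eq_div_iff (by positivity) hM.ne']
    linear_combination ((b - a * c) + (a - c * b) - (c - b * a) - (1 - c) * (1 + a) * (1 + b))
      * (1 + c) * (1 - a) * (1 - b) * hD2
  rw [hS, hC]
  field_simp

/-- The tangent of half the angle sum that occurs in the edge weights, in terms of the Gram
matrix of the vertices. -/
lemma tan_half_sphAngle {u v w : E3} (hu : ‖u‖ = 1) (hv : ‖v‖ = 1) (hw : ‖w‖ = 1)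
    (hd : det3 u v w ≠ 0) :
    Real.tan ((sphAngle u v w + sphAngle v w u - sphAngle w u v) / 2)
      = (1 + inner ℝ u v - inner ℝ u w - inner ℝ v w) / |det3 u v w| := by
  have hd1 : det3 v w u ≠ 0 := by rwa [det3_rotate]
  have hd2 : det3 w u v ≠ 0 := by rwa [det3_rotate]
  have p1 := sinDist_pos hu hv hd
  have p2 := sinDist_pos hv hw hd1
  have p3 := sinDist_pos hw hu hd2
  have q1 := sinDist_sq hu hv hd
  have q2 := sinDist_sq hv hw hd1
  have q3 := sinDist_sq hw hu hd2
  have hD : 0 < |det3 u v w| := abs_pos.2 hd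
  have hD2 : |det3 u v w| ^ 2 = _ := (sq_abs _).trans (det3_sq_of_unit hu hv hw)
  rw [tan_eq_sin_two_mul_div, mul_div_cancel₀ _ (two_ne_zero' ℝ), Real.sin_sub, Real.cos_sub,
    Real.sin_add, Real.cos_add, cos_sphAngle hu hv hw, cos_sphAngle hv hw hu,
    cos_sphAngle hw hu hv, sin_sphAngle hu hv hw hd, sin_sphAngle hv hw hu hd1,
    sin_sphAngle hw hu hv hd2, det3_rotate v w u, det3_rotate u v w,
    sinDist_comm v u, sinDist_comm w v, sinDist_comm u w, real_inner_comm u v,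
    real_inner_comm v w]
  rw [real_inner_comm w u] at hD2 ⊢
  exact tan_half_aux p1 p2 p3 hD q1 q2 q3 hD2

/-! ### Flag terms of a triangle and their symmetrization. -/

/-- The contribution of the triangle `u v w` to the (signed) length of the edge of the polyhedron
that is dual to `u v`, divided by `sin λ`, where `λ` is the length of `u v`. The support numbers
of `u`, `v`, `w` are `x`, `y`, `z`. -/
def edgeTerm (u v w : E3) (x y z : ℝ) : ℝ :=
  ((1 - inner ℝ u v ^ 2) * z - (inner ℝ v w - inner ℝ u w * inner ℝ u v) * y
      - (inner ℝ u w - inner ℝ v w * inner ℝ u v) * x)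
      / (|det3 u v w| * (1 - inner ℝ u v ^ 2))

/-- The contribution of a flag of a triangle to the area, computed face by face. -/
def areaTerm (u v w : E3) (x y z : ℝ) : ℝ :=
  (y - inner ℝ u v * x) * edgeTerm u v w x y z

/-- The contribution of a flag of a triangle to the quadratic form given by the edge weights. -/
def weightTerm (u v w : E3) (x y : ℝ) : ℝ :=
  x * (y - inner ℝ u v * x) *
    ((1 + inner ℝ u v - inner ℝ u w - inner ℝ v w) / (|det3 u v w| * (1 + inner ℝ u v)))

lemma areaTerm_perm_aux {a b c D x y z : ℝ} (hD : D ≠ 0) (ha : a ^ 2 < 1) (hb : b ^ 2 < 1)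
    (hc : c ^ 2 < 1) :
    (y - c * x) * (((1 - c ^ 2) * z - (a - b * c) * y - (b - a * c) * x) / (D * (1 - c ^ 2)))
    + (x - c * y) * (((1 - c ^ 2) * z - (b - a * c) * x - (a - b * c) * y) / (D * (1 - c ^ 2)))
    + (z - b * x) * (((1 - b ^ 2) * y - (a - c * b) * z - (c - a * b) * x) / (D * (1 - b ^ 2)))
    + (x - b * z) * (((1 - b ^ 2) * y - (c - a * b) * x - (a - c * b) * z) / (D * (1 - b ^ 2)))
    + (z - a * y) * (((1 - a ^ 2) * x - (b - c * a) * z - (c - b * a) * y) / (D * (1 - a ^ 2)))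
    + (y - a * z) * (((1 - a ^ 2) * x - (c - b * a) * y - (b - c * a) * z) / (D * (1 - a ^ 2)))
    = x * (y - c * x) * ((1 + c - b - a) / (D * (1 + c)))
    + y * (x - c * y) * ((1 + c - a - b) / (D * (1 + c)))
    + x * (z - b * x) * ((1 + b - c - a) / (D * (1 + b)))
    + z * (x - b * z) * ((1 + b - a - c) / (D * (1 + b)))
    + y * (z - a * y) * ((1 + a - c - b) / (D * (1 + a)))
    + z * (y - a * z) * ((1 + a - b - c) / (D * (1 + a))) := by
  have c1 : 1 + c ≠ 0 := by nlinarith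
  have c2 : 1 - c ≠ 0 := by nlinarith
  have b1 : 1 + b ≠ 0 := by nlinarith
  have b2 : 1 - b ≠ 0 := by nlinarith
  have a1 : 1 + a ≠ 0 := by nlinarith
  have a2 : 1 - a ≠ 0 := by nlinarith
  rw [show 1 - c ^ 2 = (1 + c) * (1 - c) by ring, show 1 - b ^ 2 = (1 + b) * (1 - b) by ring,
    show 1 - a ^ 2 = (1 + a) * (1 - a) by ring]
  field_simp
  ring

lemma areaTerm_perm {u v w : E3} (hu : ‖u‖ = 1) (hv : ‖v‖ = 1) (hw : ‖w‖ = 1)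
    (hd : det3 u v w ≠ 0) (x y z : ℝ) :
    areaTerm u v w x y z + areaTerm v u w y x z + areaTerm u w v x z y + areaTerm w u v z x y
      + areaTerm v w u y z x + areaTerm w v u z y x
    = weightTerm u v w x y + weightTerm v u w y x + weightTerm u w v x z + weightTerm w u v z x
      + weightTerm v w u y z + weightTerm w v u z y := by
  have e1 : |det3 v u w| = |det3 u v w| := by rw [det3_swap_left, abs_neg]
  have e2 : |det3 u w v| = |det3 u v w| := by rw [det3_swap_right, abs_neg]
  have e3 : |det3 w u v| = |det3 u v w| := by rw [det3_rotate, det3_rotate]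
  have e4 : |det3 v w u| = |det3 u v w| := by rw [det3_rotate]
  have e5 : |det3 w v u| = |det3 u v w| := by rw [det3_swap_right, det3_rotate, det3_rotate, abs_neg]
  have hd1 : det3 v w u ≠ 0 := by rwa [det3_rotate]
  have hd2 : det3 u w v ≠ 0 := by rw [det3_swap_right]; exact neg_ne_zero.2 hd
  simp only [areaTerm, edgeTerm, weightTerm, e1, e2, e3, e4, e5, real_inner_comm u v, real_inner_comm u w,
    real_inner_comm v w]
  exact areaTerm_perm_aux (abs_ne_zero.2 hd) (inner_sq_lt_one_of_det3_ne_zero hv hw hd1)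
    (inner_sq_lt_one_of_det3_ne_zero hu hw hd2) (inner_sq_lt_one_of_det3_ne_zero hu hv hd)

/-- Two sums over triples agree if the symmetrizations of their summands agree. -/
lemma sum_triple_congr_of_perm {ι : Type*} [Fintype ι] (F G : ι → ι → ι → ℝ)
    (hFG : ∀ i j k, F i j k + F j i k + F i k j + F k i j + F j k i + F k j i
      = G i j k + G j i k + G i k j + G k i j + G j k i + G k j i) :
    ∑ i, ∑ j, ∑ k, F i j k = ∑ i, ∑ j, ∑ k, G i j k := by
  -- Each of the six permutations only reindexes the full triple sum, so symmetrizing multiplies it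
  -- by 6.
  have key : ∀ H : ι → ι → ι → ℝ,
      ∑ i, ∑ j, ∑ k, (H i j k + H j i k + H i k j + H k i j + H j k i + H k j i)
        = 6 * ∑ i, ∑ j, ∑ k, H i j k := by
    intro H
    simp only [Finset.sum_add_distrib]
    have s1 : ∑ i, ∑ j, ∑ k, H j i k = ∑ i, ∑ j, ∑ k, H i j k := Finset.sum_comm
    have s2 : ∀ K : ι → ι → ι → ℝ, ∑ i, ∑ j, ∑ k, K i k j = ∑ i, ∑ j, ∑ k, K i j k :=
      fun K => Finset.sum_congr rfl fun i _ => Finset.sum_comm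
    have s3 : ∑ i, ∑ j, ∑ k, H k i j = ∑ i, ∑ j, ∑ k, H i j k := by
      rw [s2 (fun i j k => H j i k)]; exact s1
    have s4 : ∑ i, ∑ j, ∑ k, H j k i = ∑ i, ∑ j, ∑ k, H i j k := by
      rw [← s2 H]; exact Finset.sum_comm
    have s5 : ∑ i, ∑ j, ∑ k, H k j i = ∑ i, ∑ j, ∑ k, H i j k := by
      rw [s2 (fun i j k => H j k i)]; exact s4
    rw [s1, s2 H, s3, s4, s5]; ring
  have h6 := (key F).symm.trans ((Finset.sum_congr rfl fun i _ => Finset.sum_congr rfl fun j _ =>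
    Finset.sum_congr rfl fun k _ => hFG i j k).trans (key G))
  linarith

/-! ### The quadratic form of the weights as a sum over flags. -/

/-- The vertices which span a triangle of `T` together with the vertices `i` and `j`. -/
def thirdVertices {n : ℕ} (T : Finset (Finset (Fin n))) (i j : Fin n) : Finset (Fin n) :=
  Finset.univ.filter fun k => i ≠ j ∧ k ≠ i ∧ k ≠ j ∧ {i, j, k} ∈ T

lemma mem_thirdVertices {n : ℕ} {T : Finset (Finset (Fin n))} {i j k : Fin n} :
    k ∈ thirdVertices T i j ↔ i ≠ j ∧ k ≠ i ∧ k ≠ j ∧ {i, j, k} ∈ T := by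
  simp [thirdVertices]

lemma mem_thirdVertices_swap_left {n : ℕ} {T : Finset (Finset (Fin n))} {i j k : Fin n} :
    k ∈ thirdVertices T j i ↔ k ∈ thirdVertices T i j := by
  rw [mem_thirdVertices, mem_thirdVertices, Finset.insert_comm]
  tauto

lemma mem_thirdVertices_swap_right {n : ℕ} {T : Finset (Finset (Fin n))} {i j k : Fin n} :
    j ∈ thirdVertices T i k ↔ k ∈ thirdVertices T i j := by
  rw [mem_thirdVertices, mem_thirdVertices, Finset.pair_comm]
  tauto

section WeightForm

variable {n : ℕ} {p : Fin n → E3} {T : Finset (Finset (Fin n))} {h : Fin n → ℝ}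

lemma IsSphereTriangulation.det3_ne_zero (hT : IsSphereTriangulation p T) {i j k : Fin n}
    (hk : k ∈ thirdVertices T i j) : det3 (p i) (p j) (p k) ≠ 0 := by
  obtain ⟨hij, hki, hkj, hmem⟩ := mem_thirdVertices.1 hk
  have hl := hT.nondegenerate _ hmem
  let f : Fin 3 → ({i, j, k} : Finset (Fin n)) :=
    ![⟨i, by simp⟩, ⟨j, by simp⟩, ⟨k, by simp⟩]
  have hf : Function.Injective f := by
    intro a b hab
    fin_cases a <;> fin_cases b <;> simp [f] at hab ⊢ <;> tauto
  have h3 := hl.comp f hf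
  apply det3_ne_zero_of_linearIndependent
  convert h3 using 1
  ext a
  fin_cases a <;> rfl

lemma sum_areaTerm_eq_sum_weightTerm (hunit : ∀ i, ‖p i‖ = 1) (hT : IsSphereTriangulation p T) :
    ∑ i, ∑ j, ∑ k ∈ thirdVertices T i j, areaTerm (p i) (p j) (p k) (h i) (h j) (h k)
      = ∑ i, ∑ j, ∑ k ∈ thirdVertices T i j, weightTerm (p i) (p j) (p k) (h i) (h j) := by
  classical
  -- Extension by zero to all triples; the condition for being a triangle is invariant under
  -- permutations, so the symmetrized sums can be compared triangle by triangle.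
  have conv : ∀ H : Fin n → Fin n → Fin n → ℝ, ∑ i, ∑ j, ∑ k ∈ thirdVertices T i j, H i j k
      = ∑ i, ∑ j, ∑ k, if k ∈ thirdVertices T i j then H i j k else 0 := by
    intro H
    simp only [Finset.sum_ite_mem, Finset.univ_inter]
  rw [conv, conv]
  apply sum_triple_congr_of_perm
  intro i j k
  have m1 : k ∈ thirdVertices T j i ↔ k ∈ thirdVertices T i j := mem_thirdVertices_swap_left
  have m2 : j ∈ thirdVertices T i k ↔ k ∈ thirdVertices T i j := mem_thirdVertices_swap_right
  have m3 : j ∈ thirdVertices T k i ↔ k ∈ thirdVertices T i j := mem_thirdVertices_swap_left.trans m2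
  have m4 : i ∈ thirdVertices T j k ↔ k ∈ thirdVertices T i j :=
    mem_thirdVertices_swap_right.trans m1
  have m5 : i ∈ thirdVertices T k j ↔ k ∈ thirdVertices T i j := mem_thirdVertices_swap_left.trans m4
  simp only [m1, m2, m3, m4, m5]
  split_ifs with hk
  · exact areaTerm_perm (hunit i) (hunit j) (hunit k) (hT.det3_ne_zero hk) _ _ _
  · rfl

lemma edgeWeight_eq (hunit : ∀ i, ‖p i‖ = 1) (hT : IsSphereTriangulation p T) (i j : Fin n) :
    edgeWeight p T i j = ∑ k ∈ thirdVertices T i j,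
      (1 + inner ℝ (p i) (p j) - inner ℝ (p i) (p k) - inner ℝ (p j) (p k))
        / (|det3 (p i) (p j) (p k)| * (1 + inner ℝ (p i) (p j))) := by
  have hc : 2 * Real.cos (edgeLen p i j / 2) ^ 2 = 1 + inner ℝ (p i) (p j) := by
    rw [Real.cos_sq, mul_div_cancel₀ _ (two_ne_zero' ℝ), edgeLen,
      InnerProductGeometry.cos_angle, hunit, hunit]
    ring
  rw [edgeWeight, hc, Finset.sum_div]
  refine Finset.sum_congr rfl fun k hk => ?_
  rw [tan_half_sphAngle (hunit i) (hunit j) (hunit k) (hT.det3_ne_zero hk), div_div]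

lemma vertexWeight_eq (hunit : ∀ i, ‖p i‖ = 1) (i : Fin n) :
    vertexWeight p T i = ∑ j, edgeWeight p T i j * ((1 - inner ℝ (p i) (p j)) / 2) := by
  refine Finset.sum_congr rfl fun j _ => ?_
  rw [Real.sin_sq, Real.cos_sq, mul_div_cancel₀ _ (two_ne_zero' ℝ), edgeLen,
      InnerProductGeometry.cos_angle, hunit, hunit]
  ring

/-- Since 2 sin²(λ/2) - 1 = -cos λ, the edge weight c_ij appears with the factor h_i (h_j - h_i cos
λ_ij). -/
lemma weight_form_eq_sum (hunit : ∀ i, ‖p i‖ = 1) (hT : IsSphereTriangulation p T) :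
    2 * dInner (vertexWeight p T) h h + weakSphLaplacian p T h h
      = ∑ i, ∑ j, ∑ k ∈ thirdVertices T i j, weightTerm (p i) (p j) (p k) (h i) (h j) := by
  rw [dInner, weakSphLaplacian, Finset.mul_sum, ← Finset.sum_add_distrib]
  refine Finset.sum_congr rfl fun i _ => ?_
  rw [vertexWeight_eq hunit, Finset.sum_mul, Finset.sum_mul, Finset.mul_sum, Finset.mul_sum,
    ← Finset.sum_add_distrib]
  refine Finset.sum_congr rfl fun j _ => ?_
  simp only [weightTerm]
  rw [← Finset.mul_sum, ← edgeWeight_eq hunit hT]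
  ring

lemma dInner_sphLaplacian (hd : ∀ i, vertexWeight p T i ≠ 0) :
    dInner (vertexWeight p T) h (2 • h + sphLaplacian p T h)
      = 2 * dInner (vertexWeight p T) h h + weakSphLaplacian p T h h := by
  rw [dInner, dInner, weakSphLaplacian, Finset.mul_sum, ← Finset.sum_add_distrib]
  refine Finset.sum_congr rfl fun i _ => ?_
  simp only [two_smul, Pi.add_apply, sphLaplacian]
  have := hd i
  field_simp
  ring

end WeightForm

/-! ### Decomposing a polytope into cones over its facets. -/

/-- The union of the segments from the origin to the points of `s`. -/
def coneOver {E : Type*} [AddCommGroup E] [Module ℝ E] (s : Set E) : Set E :=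
  (fun q : ℝ × E => q.1 • q.2) '' (Set.Icc (0 : ℝ) 1 ×ˢ s)

lemma mem_coneOver {E : Type*} [AddCommGroup E] [Module ℝ E] {s : Set E} {x : E} :
    x ∈ coneOver s ↔ ∃ m : ℝ, 0 ≤ m ∧ m ≤ 1 ∧ ∃ z ∈ s, m • z = x := by
  simp only [coneOver, Set.mem_image, Set.mem_prod, Set.mem_Icc, Prod.exists]
  constructor
  · rintro ⟨m, z, ⟨⟨h0, h1⟩, hz⟩, rfl⟩
    exact ⟨m, h0, h1, z, hz, rfl⟩
  · rintro ⟨m, h0, h1, z, hz, rfl⟩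
    exact ⟨m, z, ⟨⟨h0, h1⟩, hz⟩, rfl⟩

section ConeDecomposition

variable {E : Type*} [NormedAddCommGroup E] [NormedSpace ℝ E]

lemma IsCompact.coneOver {s : Set E} (hs : IsCompact s) : IsCompact (coneOver s) :=
  (isCompact_Icc.prod hs).image (by fun_prop)

variable {ι : Type*} {g : ι → E →L[ℝ] ℝ}

/-- Otherwise the whole ray through y satisfies the inequalities. -/
lemma exists_pos_of_bounded (hb : Bornology.IsBounded {y | ∀ j, g j y ≤ 1}) {y : E} (hy : y ≠ 0) :
    ∃ j, 0 < g j y := by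
  by_contra! hneg
  obtain ⟨C, hC⟩ := hb.exists_norm_le
  have hC0 : 0 ≤ C := (norm_nonneg _).trans (hC 0 (by simp))
  have hy' := norm_pos_iff.2 hy
  have := hC (((C + 1) / ‖y‖) • y) fun j => by
    rw [map_smul, smul_eq_mul]
    exact (mul_nonpos_of_nonneg_of_nonpos (by positivity) (hneg j)).trans zero_le_one
  rw [norm_smul, Real.norm_of_nonneg (by positivity), div_mul_cancel₀ _ hy'.ne'] at this
  linarith

lemma subset_insert_iUnion_coneOver [Finite ι] (hb : Bornology.IsBounded {y | ∀ j, g j y ≤ 1}) :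
    {y | ∀ j, g j y ≤ 1} ⊆ {0} ∪ ⋃ j, coneOver {y | (∀ k, g k y ≤ 1) ∧ g j y = 1} := by
  intro y hy
  rcases eq_or_ne y 0 with h0 | h0
  · exact Or.inl h0
  obtain ⟨j₀, hj₀⟩ := exists_pos_of_bounded hb h0
  have : Nonempty ι := ⟨j₀⟩
  -- The maximal functional value at y is the gauge of y; dividing by it pushes y onto a facet where
  -- the maximum is attained.
  obtain ⟨j, hj⟩ := Finite.exists_max fun k => g k y
  have hm : 0 < g j y := hj₀.trans_le (hj j₀)
  refine Or.inr (Set.mem_iUnion.2 ⟨j, mem_coneOver.2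
    ⟨g j y, hm.le, hy j, (g j y)⁻¹ • y, ⟨fun k => ?_, ?_⟩, ?_⟩⟩)
  · rw [map_smul, smul_eq_mul, inv_mul_le_iff₀ hm, mul_one]
    exact hj k
  · rw [map_smul, smul_eq_mul, inv_mul_cancel₀ hm.ne']
  · rw [smul_smul, mul_inv_cancel₀ hm.ne', one_smul]

lemma coneOver_face_subset (j : ι) :
    coneOver {y | (∀ k, g k y ≤ 1) ∧ g j y = 1} ⊆ {y | ∀ k, g k y ≤ 1} := by
  intro x hx k
  obtain ⟨m, h0, h1, z, ⟨hz, -⟩, rfl⟩ := mem_coneOver.1 hx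
  rw [map_smul, smul_eq_mul]
  nlinarith [hz k]

/-- On the cone over the j-th facet g_j is the largest functional, so on an overlap the two
functionals agree. For distinct functionals this is a null set. -/
lemma coneOver_inter_subset (j k : ι) :
    coneOver {y | (∀ l, g l y ≤ 1) ∧ g j y = 1} ∩ coneOver {y | (∀ l, g l y ≤ 1) ∧ g k y = 1}
      ⊆ {y | (g j - g k) y = 0} := by
  have key : ∀ j k : ι, ∀ x ∈ coneOver {y | (∀ l, g l y ≤ 1) ∧ g j y = 1}, g k x ≤ g j x := by
    intro j k x hx
    obtain ⟨m, h0, h1, z, ⟨hz, hzj⟩, rfl⟩ := mem_coneOver.1 hx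
    rw [map_smul, map_smul, hzj]
    exact mul_le_mul_of_nonneg_left (hz k) h0
  rintro x ⟨hj, hk⟩
  exact sub_eq_zero.2 (le_antisymm (key k j x hk) (key j k x hj))

lemma isCompact_face [FiniteDimensional ℝ E] (hb : Bornology.IsBounded {y | ∀ j, g j y ≤ 1}) (j : ι) :
    IsCompact {y | (∀ k, g k y ≤ 1) ∧ g j y = 1} := by
  have := FiniteDimensional.proper_real E
  refine Metric.isCompact_of_isClosed_isBounded ?_ (hb.subset fun y hy => hy.1)
  have : {y | (∀ k, g k y ≤ 1) ∧ g j y = 1} = (⋂ k, {y | g k y ≤ 1}) ∩ {y | g j y = 1} := by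
    ext; simp
  rw [this]
  exact (isClosed_iInter fun k => isClosed_le (g k).continuous continuous_const).inter
    (isClosed_eq (g j).continuous continuous_const)

variable [FiniteDimensional ℝ E] [MeasurableSpace E] [BorelSpace E]

lemma measure_ker_eq_zero (μ : Measure E) [μ.IsAddHaarMeasure] {f : E →L[ℝ] ℝ} (hf : f ≠ 0) :
    μ {y | f y = 0} = 0 := by
  refine Measure.addHaar_submodule μ (LinearMap.ker (f : E →ₗ[ℝ] ℝ)) fun h => hf ?_
  ext y
  have : y ∈ LinearMap.ker (f : E →ₗ[ℝ] ℝ) := h ▸ Submodule.mem_top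
  simpa using this

/-- A bounded polytope with the origin in its interior is decomposed into the cones over its
facets. -/
lemma measure_polytope_eq_sum_coneOver [Fintype ι] [Nontrivial E] (μ : Measure E)
    [μ.IsAddHaarMeasure] (hb : Bornology.IsBounded {y | ∀ j, g j y ≤ 1})
    (hg : Function.Injective g) :
    μ {y | ∀ j, g j y ≤ 1} = ∑ j, μ (coneOver {y | (∀ k, g k y ≤ 1) ∧ g j y = 1}) := by
  have hU : μ (⋃ j, coneOver {y | (∀ k, g k y ≤ 1) ∧ g j y = 1})
      = ∑ j, μ (coneOver {y | (∀ k, g k y ≤ 1) ∧ g j y = 1}) := by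
    rw [measure_iUnion₀, tsum_fintype]
    · intro j k hjk
      exact measure_mono_null (coneOver_inter_subset j k)
        (measure_ker_eq_zero μ (sub_ne_zero.2 (hg.ne hjk)))
    · exact fun j => (isCompact_face hb j).coneOver.isClosed.measurableSet.nullMeasurableSet
  rw [← hU]
  refine le_antisymm ?_ (measure_mono (Set.iUnion_subset coneOver_face_subset))
  refine (measure_mono (subset_insert_iUnion_coneOver hb)).trans ((measure_union_le _ _).trans ?_)
  rw [measure_singleton, zero_add]

end ConeDecomposition

/-! ### The area of a triangle -/

lemma volume_standard_triangle :
    volume {y : EuclideanSpace ℝ (Fin 2) | 0 ≤ y 0 ∧ 0 ≤ y 1 ∧ y 0 + y 1 ≤ 1}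
      = ENNReal.ofReal (1 / 2) := by
  have mp := (volume_preserving_finTwoArrow ℝ).comp
    (PiLp.volume_preserving_ofLp (Fin 2))
  have hset : {y : EuclideanSpace ℝ (Fin 2) | 0 ≤ y 0 ∧ 0 ≤ y 1 ∧ y 0 + y 1 ≤ 1}
      = (MeasurableEquiv.finTwoArrow ∘ WithLp.ofLp) ⁻¹'
        {q : ℝ × ℝ | 0 ≤ q.1 ∧ 0 ≤ q.2 ∧ q.1 + q.2 ≤ 1} := by
    ext y; simp
  have hcl : IsClosed {q : ℝ × ℝ | 0 ≤ q.1 ∧ 0 ≤ q.2 ∧ q.1 + q.2 ≤ 1} :=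
    (isClosed_le continuous_const continuous_fst).inter
      ((isClosed_le continuous_const continuous_snd).inter
        (isClosed_le (continuous_fst.add continuous_snd) continuous_const))
  rw [hset, mp.measure_preimage hcl.measurableSet.nullMeasurableSet,
    Measure.volume_eq_prod, Measure.prod_apply hcl.measurableSet]
  have hslice : ∀ x : ℝ, volume (Prod.mk x ⁻¹' {q : ℝ × ℝ | 0 ≤ q.1 ∧ 0 ≤ q.2 ∧ q.1 + q.2 ≤ 1})
      = (Set.Icc (0 : ℝ) 1).indicator (fun x => ENNReal.ofReal (1 - x)) x := by
    intro x
    by_cases hx : 0 ≤ x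
    · have : Prod.mk x ⁻¹' {q : ℝ × ℝ | 0 ≤ q.1 ∧ 0 ≤ q.2 ∧ q.1 + q.2 ≤ 1}
          = Set.Icc 0 (1 - x) := by
        ext y; simp only [Set.mem_preimage, Set.mem_ofPred_eq, Set.mem_Icc]
        constructor
        · rintro ⟨-, h1, h2⟩; exact ⟨h1, by linarith⟩
        · rintro ⟨h1, h2⟩; exact ⟨hx, h1, by linarith⟩
      rw [this, Real.volume_Icc, sub_zero]
      by_cases hx1 : x ≤ 1
      · rw [Set.indicator_of_mem (Set.mem_Icc.2 ⟨hx, hx1⟩)]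
      · rw [Set.indicator_of_notMem (fun h => hx1 h.2), ENNReal.ofReal_of_nonpos (by linarith)]
    · rw [Set.indicator_of_notMem (fun h => hx h.1)]
      have : Prod.mk x ⁻¹' {q : ℝ × ℝ | 0 ≤ q.1 ∧ 0 ≤ q.2 ∧ q.1 + q.2 ≤ 1} = ∅ := by
        ext y; simp [hx]
      rw [this, measure_empty]
  simp only [hslice]
  rw [lintegral_indicator measurableSet_Icc, ← ofReal_integral_eq_lintegral_ofReal,
    integral_Icc_eq_integral_Ioc, ← intervalIntegral.integral_of_le zero_le_one]
  · congr 1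
    rw [intervalIntegral.integral_sub intervalIntegrable_const
      (continuous_id'.intervalIntegrable _ _), integral_id]
    norm_num
  · exact (continuous_const.sub continuous_id).continuousOn.integrableOn_Icc
  · filter_upwards [ae_restrict_mem measurableSet_Icc] with x hx
    exact sub_nonneg.2 hx.2

/-- The cone is the image of the standard triangle under the matrix with columns a and b; the
determinant formula also covers the degenerate case. -/
lemma volume_coneOver_segment (a b : EuclideanSpace ℝ (Fin 2)) :
    volume (coneOver (segment ℝ a b)) = ENNReal.ofReal (|a 0 * b 1 - a 1 * b 0| / 2) := by
  let B := (EuclideanSpace.basisFun (Fin 2) ℝ).toBasis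
  let A : Matrix (Fin 2) (Fin 2) ℝ := !![a 0, b 0; a 1, b 1]
  have happ : ∀ y, Matrix.toLin B B A y = y 0 • a + y 1 • b := by
    intro y
    ext i
    rw [Matrix.toLin_apply]
    fin_cases i <;> simp [B, A, Matrix.mulVec, dotProduct, Fin.sum_univ_two, EuclideanSpace.single] <;> ring
  have himg : coneOver (segment ℝ a b) = Matrix.toLin B B A ''
      {y : EuclideanSpace ℝ (Fin 2) | 0 ≤ y 0 ∧ 0 ≤ y 1 ∧ y 0 + y 1 ≤ 1} := by
    ext x
    rw [mem_coneOver, Set.mem_image]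
    constructor
    · rintro ⟨m, h0, h1, z, ⟨r, s, hr, hs, hrs, rfl⟩, rfl⟩
      refine ⟨!₂[m * r, m * s], ⟨?_, ?_, ?_⟩, ?_⟩
      · simpa using mul_nonneg h0 hr
      · simpa using mul_nonneg h0 hs
      · simpa [← mul_add, hrs] using h1
      · rw [happ]; simp [mul_smul]
    · rintro ⟨y, ⟨h0, h1, h2⟩, rfl⟩
      rw [happ]
      rcases (add_nonneg h0 h1).eq_or_lt with hz | hz
      · have e0 : y 0 = 0 := by linarith
        have e1 : y 1 = 0 := by linarith
        exact ⟨0, le_rfl, zero_le_one, a, left_mem_segment ℝ a b, by simp [e0, e1]⟩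
      · refine ⟨y 0 + y 1, hz.le, h2, (y 0 / (y 0 + y 1)) • a + (y 1 / (y 0 + y 1)) • b,
          ⟨_, _, by positivity, by positivity, ?_, rfl⟩, ?_⟩
        · field_simp
        · rw [smul_add, smul_smul, smul_smul, mul_div_cancel₀ _ hz.ne', mul_div_cancel₀ _ hz.ne']
  rw [himg, Measure.addHaar_image_linearMap, LinearMap.det_toLin, volume_standard_triangle,
    ← ENNReal.ofReal_mul (abs_nonneg _), Matrix.det_fin_two]
  simp only [A, Matrix.of_apply, Matrix.cons_val', Matrix.cons_val_zero, Matrix.cons_val_one,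
    Matrix.cons_val_fin_one]
  rw [mul_one_div, mul_comm (b 0)]

/-! ### Isometric parametrization of the plane of a face -/

/-- The linear parametrization of the orthogonal complement of `p` by the orthonormal basis
`u, cross3 p u`. -/
def planeMap (p u : E3) : EuclideanSpace ℝ (Fin 2) →ₗ[ℝ] E3 where
  toFun y := y 0 • u + y 1 • cross3 p u
  map_add' x y := by simp only [PiLp.add_apply]; module
  map_smul' r y := by simp only [PiLp.smul_apply, smul_eq_mul, RingHom.id_apply]; module

lemma planeMap_apply (p u : E3) (y : EuclideanSpace ℝ (Fin 2)) :
    planeMap p u y = y 0 • u + y 1 • cross3 p u := rfl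

lemma inner_cross3_right (u v : E3) : inner ℝ v (cross3 u v) = (0 : ℝ) := by
  rw [real_inner_comm, inner_cross3, det3_self_right]

lemma inner_cross3_self (u v : E3) : inner ℝ (cross3 u v) (cross3 u v)
    = inner ℝ u u * inner ℝ v v - (inner ℝ u v : ℝ) ^ 2 := by
  simp only [inner_E3, cross3]; simp; ring

lemma det3_cross3 (u v w : E3) :
    det3 u w (cross3 u v) = inner ℝ u u * inner ℝ w v - inner ℝ u v * inner ℝ w u := by
  simp only [inner_E3, cross3, det3]; simp; ring

section PlaneMap

variable {p u : E3}

lemma inner_planeMap (hpu : inner ℝ p u = (0 : ℝ)) (y : EuclideanSpace ℝ (Fin 2)) :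
    inner ℝ (planeMap p u y) p = (0 : ℝ) := by
  rw [planeMap_apply, inner_add_left, inner_smul_left, inner_smul_left, real_inner_comm, hpu,
    inner_cross3, det3_self_left]
  simp

lemma norm_planeMap (hp : ‖p‖ = 1) (hu : ‖u‖ = 1) (hpu : inner ℝ p u = (0 : ℝ))
    (y : EuclideanSpace ℝ (Fin 2)) : ‖planeMap p u y‖ = ‖y‖ := by
  have hcc : inner ℝ (cross3 p u) (cross3 p u) = (1 : ℝ) := by
    rw [inner_cross3_self, hpu, inner_self_of_unit hp, inner_self_of_unit hu]; norm_num
  rw [← sq_eq_sq₀ (norm_nonneg _) (norm_nonneg _), EuclideanSpace.norm_sq_eq y,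
    Fin.sum_univ_two, ← real_inner_self_eq_norm_sq, planeMap_apply]
  simp only [inner_add_left, inner_add_right, inner_smul_left, inner_smul_right,
    real_inner_comm u (cross3 p u), inner_cross3_right, hcc, inner_self_of_unit hu, conj_trivial,
    Real.norm_eq_abs, sq_abs]
  ring

lemma exists_planeMap_eq (hp : ‖p‖ = 1) (hu : ‖u‖ = 1) (hpu : inner ℝ p u = (0 : ℝ)) {x : E3}
    (hx : inner ℝ x p = (0 : ℝ)) : ∃ y, planeMap p u y = x := by
  have hxu : inner ℝ (x - (inner ℝ x u : ℝ) • u) u = (0 : ℝ) := by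
    rw [inner_sub_left, inner_smul_left, inner_self_of_unit hu]; simp
  have hxp : inner ℝ (x - (inner ℝ x u : ℝ) • u) p = (0 : ℝ) := by
    rw [inner_sub_left, inner_smul_left, real_inner_comm, real_inner_comm p u] at *
    rw [hx, hpu]; simp
  have := smul_eq_det3_smul_cross3 hxp hxu
  rw [hpu, inner_self_of_unit hp, inner_self_of_unit hu] at this
  refine ⟨!₂[inner ℝ x u, det3 p u (x - (inner ℝ x u : ℝ) • u)], ?_⟩
  rw [planeMap_apply]
  simp only [Matrix.cons_val_zero, Matrix.cons_val_one, Matrix.cons_val_fin_one]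
  rw [← this]; module

lemma det3_planeMap (hp : ‖p‖ = 1) (hu : ‖u‖ = 1) (hpu : inner ℝ p u = (0 : ℝ))
    (a b : EuclideanSpace ℝ (Fin 2)) :
    det3 p (planeMap p u a) (planeMap p u b) = a 0 * b 1 - a 1 * b 0 := by
  have h1 : det3 p u (cross3 p u) = 1 := by
    rw [det3_cross3, inner_self_of_unit hp, inner_self_of_unit hu, hpu]; norm_num
  have : det3 p (planeMap p u a) (planeMap p u b)
      = (a 0 * b 1 - a 1 * b 0) * det3 p u (cross3 p u) := by
    simp only [planeMap_apply, det3, PiLp.add_apply, PiLp.smul_apply, smul_eq_mul]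
    ring
  rw [this, h1, mul_one]

/-- The isometric parametrization of the plane orthogonal to `p` through the point `o`. -/
def affinePlaneMap (p u o : E3) (y : EuclideanSpace ℝ (Fin 2)) : E3 := o + planeMap p u y

lemma isometry_affinePlaneMap (hp : ‖p‖ = 1) (hu : ‖u‖ = 1) (hpu : inner ℝ p u = (0 : ℝ))
    (o : E3) : Isometry (affinePlaneMap p u o) := by
  refine Isometry.of_dist_eq fun x y => ?_
  rw [affinePlaneMap, affinePlaneMap, dist_add_left, dist_eq_norm, dist_eq_norm, ← map_sub,
    norm_planeMap hp hu hpu]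

lemma exists_affinePlaneMap_eq (hp : ‖p‖ = 1) (hu : ‖u‖ = 1) (hpu : inner ℝ p u = (0 : ℝ))
    {o x : E3} (hx : inner ℝ x p = (inner ℝ o p : ℝ)) : ∃ y, affinePlaneMap p u o y = x := by
  obtain ⟨y, hy⟩ := exists_planeMap_eq hp hu hpu (x := x - o)
    (by rw [inner_sub_left, hx, sub_self])
  exact ⟨y, by rw [affinePlaneMap, hy, add_sub_cancel]⟩

lemma inner_affinePlaneMap (hpu : inner ℝ p u = (0 : ℝ)) (o : E3)
    (y : EuclideanSpace ℝ (Fin 2)) : inner ℝ (affinePlaneMap p u o y) p = (inner ℝ o p : ℝ) := by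
  rw [affinePlaneMap, inner_add_left, inner_planeMap hpu, add_zero]

lemma preimage_segment_affinePlaneMap (hp : ‖p‖ = 1) (hu : ‖u‖ = 1)
    (hpu : inner ℝ p u = (0 : ℝ)) (o : E3) (a b : EuclideanSpace ℝ (Fin 2)) :
    affinePlaneMap p u o ⁻¹' segment ℝ (affinePlaneMap p u o a) (affinePlaneMap p u o b)
      = segment ℝ a b := by
  have hinj := (isometry_affinePlaneMap hp hu hpu o).injective
  have himg : affinePlaneMap p u o '' segment ℝ a b
      = segment ℝ (affinePlaneMap p u o a) (affinePlaneMap p u o b) := by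
    let f : EuclideanSpace ℝ (Fin 2) →ᵃ[ℝ] E3 := (planeMap p u).toAffineMap + AffineMap.const ℝ _ o
    have hf : affinePlaneMap p u o = f := funext fun y => add_comm _ _
    rw [hf]
    exact image_segment ℝ f a b
  rw [← himg, Set.preimage_image_eq _ hinj]

lemma euclideanHausdorffMeasure_eq_volume_preimage (hp : ‖p‖ = 1) (hu : ‖u‖ = 1)
    (hpu : inner ℝ p u = (0 : ℝ)) {o : E3} {s : Set E3}
    (hs : ∀ x ∈ s, inner ℝ x p = (inner ℝ o p : ℝ)) :
    μHE[2] s = volume (affinePlaneMap p u o ⁻¹' s) := by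
  have hsub : s ⊆ Set.range (affinePlaneMap p u o) := fun x hx =>
    exists_affinePlaneMap_eq hp hu hpu (hs x hx)
  have himg := Set.image_preimage_eq_of_subset hsub
  rw [← EuclideanSpace.euclideanHausdorffMeasure_eq_volume 2,
    ← Isometry.euclideanHausdorffMeasure_image (isometry_affinePlaneMap hp hu hpu o), himg]

end PlaneMap

/-! ### The area of a face, cut into triangles from a relative interior point. -/

/-- The linear functional `y ↦ ⟨planeMap p u y, q⟩ / s`. -/
def facetFunctional (p u q : E3) (s : ℝ) : EuclideanSpace ℝ (Fin 2) →L[ℝ] ℝ :=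
  LinearMap.toContinuousLinearMap (s⁻¹ • ((innerSL ℝ q).toLinearMap ∘ₗ planeMap p u))

lemma facetFunctional_apply (p u q : E3) (s : ℝ) (y : EuclideanSpace ℝ (Fin 2)) :
    facetFunctional p u q s y = s⁻¹ * inner ℝ (planeMap p u y) q := by
  simp [facetFunctional, real_inner_comm]

section Face

variable {n : ℕ} {p : Fin n → E3} {h : Fin n → ℝ}

/-- The point `o` satisfies the `i`-th inequality with equality and all others strictly. -/
def IsFaceInterior (p : Fin n → E3) (h : Fin n → ℝ) (i : Fin n) (o : E3) : Prop :=
  inner ℝ o (p i) = h i ∧ ∀ j, j ≠ i → inner ℝ o (p j) < h j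

variable {i : Fin n} {u o : E3}

lemma facetFunctional_le_one_iff (ho : IsFaceInterior p h i o) {j : Fin n} (hj : j ≠ i)
    (y : EuclideanSpace ℝ (Fin 2)) :
    facetFunctional (p i) u (p j) (h j - inner ℝ o (p j)) y ≤ 1
      ↔ inner ℝ (affinePlaneMap (p i) u o y) (p j) ≤ h j := by
  rw [facetFunctional_apply, affinePlaneMap, inner_add_left,
    inv_mul_le_iff₀ (sub_pos.2 (ho.2 j hj)), mul_one, le_sub_iff_add_le']

lemma facetFunctional_eq_one_iff (ho : IsFaceInterior p h i o) {j : Fin n} (hj : j ≠ i)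
    (y : EuclideanSpace ℝ (Fin 2)) :
    facetFunctional (p i) u (p j) (h j - inner ℝ o (p j)) y = 1
      ↔ inner ℝ (affinePlaneMap (p i) u o y) (p j) = h j := by
  rw [facetFunctional_apply, affinePlaneMap, inner_add_left,
    inv_mul_eq_iff_eq_mul₀ (sub_pos.2 (ho.2 j hj)).ne', mul_one, eq_sub_iff_add_eq']

/-- With `o` as the origin of the plane, dividing the j-th inequality by its positive slack at `o`
gives the normalized form of the cone decomposition; the i-th is automatic. -/
lemma preimage_polyFace (hpu : inner ℝ (p i) u = (0 : ℝ)) (ho : IsFaceInterior p h i o) :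
    affinePlaneMap (p i) u o ⁻¹' polyFace p h i
      = {y | ∀ j : {j // j ≠ i},
          facetFunctional (p i) u (p j) (h j - inner ℝ o (p j)) y ≤ 1} := by
  ext y
  constructor
  · intro hy j
    exact (facetFunctional_le_one_iff ho j.2 y).2 (hy.1 j)
  · intro hy
    have hi : inner ℝ (affinePlaneMap (p i) u o y) (p i) = h i :=
      (inner_affinePlaneMap hpu o y).trans ho.1
    refine ⟨fun j => ?_, hi⟩
    rcases eq_or_ne j i with rfl | hj
    · exact hi.le
    · exact (facetFunctional_le_one_iff ho hj y).1 (hy ⟨j, hj⟩)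

lemma preimage_polyFace_inter (hpu : inner ℝ (p i) u = (0 : ℝ)) (ho : IsFaceInterior p h i o)
    (j : {j // j ≠ i}) :
    affinePlaneMap (p i) u o ⁻¹' (polyFace p h i ∩ polyFace p h j)
      = {y | (∀ k : {k // k ≠ i},
          facetFunctional (p i) u (p k) (h k - inner ℝ o (p k)) y ≤ 1) ∧
          facetFunctional (p i) u (p j) (h j - inner ℝ o (p j)) y = 1} := by
  ext y
  have h1 := Set.ext_iff.1 (preimage_polyFace hpu ho) y
  constructor
  · intro hy
    exact ⟨h1.1 hy.1, (facetFunctional_eq_one_iff ho j.2 y).2 hy.2.2⟩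
  · intro hy
    exact ⟨h1.2 hy.1, (h1.2 hy.1).1, (facetFunctional_eq_one_iff ho j.2 y).1 hy.2⟩

/-- If two functionals agree, the affine functions of the inequalities j, k, i satisfy ℓ_j = κ ℓ_k +
μ ℓ_i with κ > 0. For μ ≥ 0 inequality j follows from k and i, for μ < 0 inequality k follows from j
and i; either contradicts non-redundancy. -/
lemma facetFunctional_injective (hunit : ∀ i, ‖p i‖ = 1) (hu : ‖u‖ = 1)
    (hpu : inner ℝ (p i) u = (0 : ℝ)) (ho : IsFaceInterior p h i o)
    (hnr : Nonredundant p h) :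
    Function.Injective fun j : {j // j ≠ i} =>
      facetFunctional (p i) u (p j) (h j - inner ℝ o (p j)) := by
  rintro ⟨j, hj⟩ ⟨k, hk⟩ hjk
  by_contra hne
  have hne : j ≠ k := fun e => hne (Subtype.ext e)
  simp only at hjk
  have sj := sub_pos.2 (ho.2 j hj)
  have sk := sub_pos.2 (ho.2 k hk)
  obtain ⟨κ, hκ, hκe⟩ : ∃ κ : ℝ, 0 < κ ∧ h j - inner ℝ o (p j) = κ * (h k - inner ℝ o (p k)) :=
    ⟨_, div_pos sj sk, (div_mul_cancel₀ _ sk.ne').symm⟩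
  have hplane : ∀ y, inner ℝ (planeMap (p i) u y) (p j)
      = κ * inner ℝ (planeMap (p i) u y) (p k) := by
    intro y
    have := congrArg (fun f : EuclideanSpace ℝ (Fin 2) →L[ℝ] ℝ => f y) hjk
    simp only [facetFunctional_apply, hκe] at this
    field_simp at this
    exact this
  obtain ⟨μ, hμ⟩ : ∃ μ : ℝ, ∀ x : E3, inner ℝ x (p j) - h j
      = κ * (inner ℝ x (p k) - h k) + μ * (inner ℝ x (p i) - h i) := by
    refine ⟨inner ℝ (p i) (p j) - κ * inner ℝ (p i) (p k), fun x => ?_⟩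
    -- The agreement is known only on the plane orthogonal to p_i, so x - o is projected there; μ
    -- accounts for the p_i-component.
    obtain ⟨y, hy⟩ := exists_planeMap_eq (hunit i) hu hpu
      (x := x - o - (inner ℝ (x - o) (p i) : ℝ) • p i)
      (by rw [inner_sub_left, inner_smul_left, inner_self_of_unit (hunit i)]; simp)
    have hy' := hplane y
    rw [hy] at hy'
    simp only [inner_sub_left, inner_smul_left, conj_trivial, ho.1] at hy'
    linear_combination hy' - hκe
  rcases le_or_gt 0 μ with hμ0 | hμ0
  · obtain ⟨x, hx, hxj⟩ := hnr j
    have h1 := hμ x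
    have h2 := hx k hne.symm
    have h3 := hx i hj.symm
    nlinarith
  · obtain ⟨x, hx, hxk⟩ := hnr k
    have h1 := hμ x
    have h2 := hx j hne
    have h3 := hx i hk.symm
    nlinarith

lemma isBounded_preimage (hunit : ∀ i, ‖p i‖ = 1) (hu : ‖u‖ = 1)
    (hpu : inner ℝ (p i) u = (0 : ℝ)) (ho : IsFaceInterior p h i o)
    (hb : Bornology.IsBounded (polyhedron p h)) :
    Bornology.IsBounded {y | ∀ j : {j // j ≠ i},
      facetFunctional (p i) u (p j) (h j - inner ℝ o (p j)) y ≤ 1} := by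
  rw [← preimage_polyFace hpu ho]
  exact (isometry_affinePlaneMap (hunit i) hu hpu o).antilipschitz.isBounded_preimage
    (hb.subset fun x hx => hx.1)

/-- The area of a face is the sum of the areas of the triangles from a relative interior point to
its edges. -/
lemma measure_polyFace_eq_sum (hunit : ∀ i, ‖p i‖ = 1) (hu : ‖u‖ = 1)
    (hpu : inner ℝ (p i) u = (0 : ℝ)) (ho : IsFaceInterior p h i o)
    (hb : Bornology.IsBounded (polyhedron p h)) (hnr : Nonredundant p h) :
    μHE[2] (polyFace p h i) = ∑ j : {j // j ≠ i},
      volume (coneOver (affinePlaneMap (p i) u o ⁻¹' (polyFace p h i ∩ polyFace p h j))) := by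
  rw [euclideanHausdorffMeasure_eq_volume_preimage (hunit i) hu hpu
    (fun x hx => hx.2.trans ho.1.symm), preimage_polyFace hpu ho,
    measure_polytope_eq_sum_coneOver volume (isBounded_preimage hunit hu hpu ho hb)
      (facetFunctional_injective hunit hu hpu ho hnr)]
  simp only [preimage_polyFace_inter hpu ho]

lemma measure_level_eq_zero {E : Type*} [NormedAddCommGroup E] [NormedSpace ℝ E]
    [FiniteDimensional ℝ E] [MeasurableSpace E] [BorelSpace E] (μ : Measure E)
    [μ.IsAddHaarMeasure] (f : E →L[ℝ] ℝ) {c : ℝ} (hc : c ≠ 0) : μ {y | f y = c} = 0 := by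
  rcases Set.eq_empty_or_nonempty {y | f y = c} with he | ⟨z, hz⟩
  · rw [he, measure_empty]
  have hz : f z = c := hz
  have hf : f ≠ 0 := fun h0 => hc (by rw [← hz, h0]; rfl)
  rw [← measure_preimage_add μ z]
  convert measure_ker_eq_zero μ hf using 2
  ext y
  simp [hz]

lemma measure_polyFace_inter (hunit : ∀ i, ‖p i‖ = 1) (ho : IsFaceInterior p h i o) {j : Fin n}
    (hj : j ≠ i) : μHE[2] (polyFace p h i ∩ polyFace p h j) = 0 := by
  obtain ⟨u, hu, hpu⟩ := exists_unit_orthogonal (p i)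
  rw [euclideanHausdorffMeasure_eq_volume_preimage (hunit i) hu hpu
    (fun x hx => hx.1.2.trans ho.1.symm), preimage_polyFace_inter hpu ho ⟨j, hj⟩]
  exact measure_mono_null (fun y hy => hy.2) (measure_level_eq_zero volume
    (facetFunctional (p i) u (p j) (h j - inner ℝ o (p j))) one_ne_zero)

/-! ### The boundary of the polyhedron as a union of faces. -/

lemma polyhedron_eq_iInter (p : Fin n → E3) (h : Fin n → ℝ) :
    polyhedron p h = ⋂ i, {x | inner ℝ x (p i) ≤ h i} := by
  ext; simp [polyhedron]

lemma isClosed_polyhedron (p : Fin n → E3) (h : Fin n → ℝ) : IsClosed (polyhedron p h) := by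
  rw [polyhedron_eq_iInter]
  exact isClosed_iInter fun i => isClosed_le (by fun_prop) continuous_const

lemma isClosed_polyFace (p : Fin n → E3) (h : Fin n → ℝ) (i : Fin n) :
    IsClosed (polyFace p h i) :=
  (isClosed_polyhedron p h).inter (isClosed_eq (by fun_prop) continuous_const)

lemma interior_polyhedron (hunit : ∀ i, ‖p i‖ = 1) :
    interior (polyhedron p h) = {x | ∀ i, inner ℝ x (p i) < h i} := by
  apply Set.Subset.antisymm
  · intro x hx i
    have hx' := interior_subset hx
    refine lt_of_le_of_ne (hx' i) fun he => ?_
    have hc : Filter.Tendsto (fun t : ℝ => x + t • p i) (nhdsWithin 0 (Set.Ioi 0)) (nhds x) := by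
      have : Continuous fun t : ℝ => x + t • p i := by fun_prop
      simpa using (this.tendsto 0).mono_left nhdsWithin_le_nhds
    obtain ⟨t, ht, ht0⟩ := ((hc.eventually (mem_interior_iff_mem_nhds.1 hx)).and
      self_mem_nhdsWithin).exists
    have h1 : inner ℝ (x + t • p i) (p i) ≤ h i := ht i
    rw [inner_add_left, inner_smul_left, inner_self_of_unit (hunit i), he] at h1
    have : 0 < t := ht0
    simp at h1
    linarith
  · have ho : IsOpen {x : E3 | ∀ i, inner ℝ x (p i) < h i} := by
      have : {x : E3 | ∀ i, inner ℝ x (p i) < h i} = ⋂ i, {x | inner ℝ x (p i) < h i} := by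
        ext; simp
      rw [this]
      exact isOpen_iInter_of_finite fun i => isOpen_lt (by fun_prop) continuous_const
    exact interior_maximal (fun x hx i => (hx i).le) ho

lemma frontier_polyhedron (hunit : ∀ i, ‖p i‖ = 1) :
    frontier (polyhedron p h) = ⋃ i, polyFace p h i := by
  rw [(isClosed_polyhedron p h).frontier_eq, interior_polyhedron hunit]
  ext x
  simp only [Set.mem_sdiff, Set.mem_iUnion, polyFace, Set.mem_ofPred_eq, not_forall, not_lt]
  constructor
  · rintro ⟨hx, i, hi⟩
    exact ⟨i, hx, le_antisymm (hx i) hi⟩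
  · rintro ⟨i, hx, hi⟩
    exact ⟨hx, i, hi.ge⟩

/-- The segment from an interior point to a point violating only the i-th inequality crosses the
i-th plane, and there the interior endpoint keeps all other inequalities strict. -/
lemma exists_isFaceInterior (hunit : ∀ i, ‖p i‖ = 1)
    (hsolid : (interior (polyhedron p h)).Nonempty) (hnr : Nonredundant p h) (i : Fin n) :
    ∃ o, IsFaceInterior p h i o := by
  obtain ⟨y, hy⟩ := hsolid
  rw [interior_polyhedron hunit] at hy
  obtain ⟨z, hz, hzi⟩ := hnr i
  have hyi := hy i
  set α : ℝ := inner ℝ y (p i) with hα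
  set β : ℝ := inner ℝ z (p i) with hβ
  have hd : 0 < β - α := by linarith
  have hr : 0 < (β - h i) / (β - α) := div_pos (by linarith) hd
  have hs : 0 < (h i - α) / (β - α) := div_pos (by linarith) hd
  have hrs : (β - h i) / (β - α) + (h i - α) / (β - α) = 1 := by field_simp; ring
  refine ⟨((β - h i) / (β - α)) • y + ((h i - α) / (β - α)) • z, ?_, fun j hj => ?_⟩
  · rw [inner_add_left, inner_smul_left, inner_smul_left, ← hα, ← hβ]
    simp only [conj_trivial]
    field_simp; ring
  · rw [inner_add_left, inner_smul_left, inner_smul_left]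
    simp only [conj_trivial]
    have h1 := mul_lt_mul_of_pos_left (hy j) hr
    have h2 := mul_le_mul_of_nonneg_left (hz j hj) hs.le
    calc _ < (β - h i) / (β - α) * h j + (h i - α) / (β - α) * h j := add_lt_add_of_lt_of_le h1 h2
      _ = h j := by rw [← add_mul, hrs, one_mul]

lemma surfaceArea_eq_sum (hunit : ∀ i, ‖p i‖ = 1)
    (hsolid : (interior (polyhedron p h)).Nonempty) (hnr : Nonredundant p h)
    (hfin : ∀ i, μHE[2] (polyFace p h i) ≠ ⊤) :
    surfaceArea (polyhedron p h) = ∑ i, (μHE[2] (polyFace p h i)).toReal := by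
  rw [surfaceArea, frontier_polyhedron hunit, measure_iUnion₀, tsum_fintype, ENNReal.toReal_sum]
  · exact fun i _ => hfin i
  · intro i j hij
    obtain ⟨o, ho⟩ := exists_isFaceInterior hunit hsolid hnr i
    exact measure_polyFace_inter hunit ho hij.symm
  · exact fun i => (isClosed_polyFace p h i).measurableSet.nullMeasurableSet

end Face

/-! ### The two triangles at an edge of the triangulation. -/

section Triangulation

variable {n : ℕ} {p : Fin n → E3} {T : Finset (Finset (Fin n))} {h : Fin n → ℝ}

lemma IsSphereTriangulation.exists_third_vertex (hT : IsSphereTriangulation p T) {i j : Fin n}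
    (hij : i ≠ j) {t : Finset (Fin n)} (ht : t ∈ T) (hi : i ∈ t) (hj : j ∈ t) :
    ∃ k ∈ thirdVertices T i j, t = {i, j, k} := by
  have hsub : {i, j} ⊆ t := by
    intro x hx
    rcases Finset.mem_insert.1 hx with rfl | hx
    · exact hi
    · rwa [Finset.mem_singleton.1 hx]
  have hcard : (t \ {i, j}).card = 1 := by
    rw [Finset.card_sdiff_of_subset hsub, hT.card_eq t ht, Finset.card_pair hij]
  obtain ⟨k, hk⟩ := Finset.card_eq_one.1 hcard
  have hkt : k ∈ t \ {i, j} := hk ▸ Finset.mem_singleton_self k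
  have hteq : t = {i, j, k} := by
    rw [← Finset.union_sdiff_of_subset hsub, hk]
    ext x; simp
  simp only [Finset.mem_sdiff, Finset.mem_insert, Finset.mem_singleton, not_or] at hkt
  exact ⟨k, mem_thirdVertices.2 ⟨hij, hkt.2.1, hkt.2.2, hteq ▸ ht⟩, hteq⟩

lemma IsSphereTriangulation.thirdVertices_eq_pair (hT : IsSphereTriangulation p T) {i j : Fin n}
    (hne : (thirdVertices T i j).Nonempty) :
    ∃ k l, k ≠ l ∧ thirdVertices T i j = {k, l} := by
  obtain ⟨k₀, hk₀⟩ := hne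
  obtain ⟨hij, hki, hkj, hmem⟩ := mem_thirdVertices.1 hk₀
  have h2 := hT.two_triangles i j hij ⟨_, hmem, by simp, by simp⟩
  have : (thirdVertices T i j).card = 2 := by
    rw [← h2]
    refine Finset.card_bij (fun k _ => {i, j, k}) (fun k hk => ?_) (fun k hk l hl hkl => ?_)
      (fun t ht => ?_)
    · exact Finset.mem_filter.2 ⟨(mem_thirdVertices.1 hk).2.2.2, by simp, by simp⟩
    · have hk' := mem_thirdVertices.1 hk
      have : k ∈ ({i, j, l} : Finset (Fin n)) := hkl ▸ by simp
      simp only [Finset.mem_insert, Finset.mem_singleton] at this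
      rcases this with h1 | h1 | h1
      · exact absurd h1 hk'.2.1
      · exact absurd h1 hk'.2.2.1
      · exact h1
    · obtain ⟨ht, hi, hj⟩ := Finset.mem_filter.1 ht
      obtain ⟨k, hk, rfl⟩ := hT.exists_third_vertex hij ht hi hj
      exact ⟨k, hk, rfl⟩
  obtain ⟨k, l, hkl, he⟩ := Finset.card_eq_two.1 this
  exact ⟨k, l, hkl, he⟩

lemma mem_sphSimplex_triple {i j k : Fin n} (hij : i ≠ j) (hki : k ≠ i) (hkj : k ≠ j) {x : E3}
    (hx : ‖x‖ = 1) {r s t : ℝ} (hr : 0 ≤ r) (hs : 0 ≤ s) (ht : 0 ≤ t)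
    (hxe : x = r • p i + s • p j + t • p k) : x ∈ sphSimplex p {i, j, k} := by
  refine ⟨hx, fun m => if m = i then r else if m = j then s else t, fun m => ?_, ?_⟩
  · simp only
    split_ifs <;> assumption
  · rw [Finset.sum_insert (by simp [hij, hki.symm]), Finset.sum_pair hkj.symm, hxe]
    simp [hij.symm, hki, hkj, add_assoc]

/-- The two triangles at an edge lie on opposite sides of it. -/
lemma IsSphereTriangulation.det3_mul_det3_neg (hT : IsSphereTriangulation p T) {i j k l : Fin n}
    (hk : k ∈ thirdVertices T i j) (hl : l ∈ thirdVertices T i j) (hkl : k ≠ l) :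
    det3 (p i) (p j) (p k) * det3 (p i) (p j) (p l) < 0 := by
  have hdk := hT.det3_ne_zero hk
  have hdl := hT.det3_ne_zero hl
  obtain ⟨hij, hki, hkj, hkT⟩ := mem_thirdVertices.1 hk
  obtain ⟨-, hli, hlj, hlT⟩ := mem_thirdVertices.1 hl
  by_contra! hnonneg
  -- This ratio is the coefficient of p_k in p_l, so its positivity says that p_k and p_l lie on the
  -- same side of ij.
  have hpos : 0 < det3 (p i) (p j) (p l) / det3 (p i) (p j) (p k) := by
    rw [← mul_pos_iff_of_pos_right (sq_pos_of_ne_zero hdk)]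
    have h1 : det3 (p i) (p j) (p l) / det3 (p i) (p j) (p k) * det3 (p i) (p j) (p k) ^ 2
        = det3 (p i) (p j) (p k) * det3 (p i) (p j) (p l) := by field_simp
    rw [h1]
    exact lt_of_le_of_ne hnonneg (mul_ne_zero hdk hdl).symm
  set γ := det3 (p i) (p j) (p l) / det3 (p i) (p j) (p k) with hγ
  set α := det3 (p l) (p j) (p k) / det3 (p i) (p j) (p k) with hα
  set β := det3 (p i) (p l) (p k) / det3 (p i) (p j) (p k) with hβ
  have hpl : p l = α • p i + β • p j + γ • p k := by
    have := congrArg (fun x => (det3 (p i) (p j) (p k))⁻¹ • x)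
      (det3_smul_eq (p i) (p j) (p k) (p l))
    simp only [smul_add, smul_smul, inv_mul_cancel₀ hdk, one_smul] at this
    rw [this, hα, hβ, hγ]
    simp only [div_eq_inv_mul]
  -- M is large enough that M p_i + M p_j + p_l has nonnegative coefficients in both triangles.
  -- After normalization this point lies in both, hence on the arc ij, although its determinant with
  -- p_i and p_j is nonzero.
  set M := |α| + |β| with hM
  have hM0 : 0 ≤ M := by positivity
  have hMα : 0 ≤ M + α := by linarith [neg_abs_le α, abs_nonneg β]
  have hMβ : 0 ≤ M + β := by linarith [neg_abs_le β, abs_nonneg α]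
  set x := M • p i + M • p j + p l with hx
  have hxk : x = (M + α) • p i + (M + β) • p j + γ • p k := by
    rw [hx, hpl]; module
  have hdx : det3 (p i) (p j) x = det3 (p i) (p j) (p l) := by
    rw [hx, det3_add_right, det3_eq_zero_of_eq_smul_add rfl, zero_add]
  have hx0 : x ≠ 0 := by
    intro h0
    apply hdl
    rw [← hdx, h0]; simp [det3]
  have hn : 0 < ‖x‖ := norm_pos_iff.2 hx0
  have hn1 : ‖‖x‖⁻¹ • x‖ = 1 := by
    rw [norm_smul, norm_inv, norm_norm, inv_mul_cancel₀ hn.ne']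
  have m1 : ‖x‖⁻¹ • x ∈ sphSimplex p {i, j, k} := by
    refine mem_sphSimplex_triple hij hki hkj hn1 (r := ‖x‖⁻¹ * (M + α)) (s := ‖x‖⁻¹ * (M + β))
      (t := ‖x‖⁻¹ * γ) (by positivity) (by positivity) (by positivity) ?_
    refine (congrArg (fun z => ‖x‖⁻¹ • z) hxk).trans ?_
    module
  have m2 : ‖x‖⁻¹ • x ∈ sphSimplex p {i, j, l} := by
    refine mem_sphSimplex_triple hij hli hlj hn1 (r := ‖x‖⁻¹ * M) (s := ‖x‖⁻¹ * M)
      (t := ‖x‖⁻¹) (by positivity) (by positivity) (by positivity) ?_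
    refine (congrArg (fun z => ‖x‖⁻¹ • z) hx).trans ?_
    module
  have hinter : ({i, j, k} ∩ {i, j, l} : Finset (Fin n)) = {i, j} := by
    ext m
    simp only [Finset.mem_inter, Finset.mem_insert, Finset.mem_singleton]
    constructor
    · rintro ⟨h1 | h1 | h1, h2 | h2 | h2⟩ <;>
        first | exact Or.inl ‹m = i› | exact Or.inr ‹m = j› | skip
      exact absurd (h1.symm.trans h2) hkl
    · rintro (h1 | h1) <;> simp [h1]
  have m3 : ‖x‖⁻¹ • x ∈ sphSimplex p ({i, j, k} ∩ {i, j, l}) :=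
    hT.inter_eq _ hkT _ hlT ▸ ⟨m1, m2⟩
  rw [hinter] at m3
  obtain ⟨-, a, -, ha⟩ := m3
  rw [Finset.sum_pair hij] at ha
  have h0 := det3_eq_zero_of_eq_smul_add ha
  rw [det3_smul_right, hdx] at h0
  exact mul_ne_zero (inv_ne_zero hn.ne') hdl h0

end Triangulation

/-! ### Edges of the polyhedron as segments between dual vertices. -/

section Edge

variable {n : ℕ} {p : Fin n → E3} {h : Fin n → ℝ} {i j k l : Fin n}

/-- Up to the orientation sign of ijk, the term is det(p_i, p_j, v) / sin² λ: the coordinate of v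
along the unit direction of p_i × p_j, divided by sin λ. Adding the terms of two oppositely oriented
triangles therefore gives a difference of positions. -/
lemma edgeTerm_eq_div (hunit : ∀ i, ‖p i‖ = 1) {v : E3} (hi : inner ℝ v (p i) = h i)
    (hj : inner ℝ v (p j) = h j) (hk : inner ℝ v (p k) = h k) :
    edgeTerm (p i) (p j) (p k) (h i) (h j) (h k)
      = det3 (p i) (p j) v * det3 (p i) (p j) (p k)
        / (|det3 (p i) (p j) (p k)| * (1 - inner ℝ (p i) (p j) ^ 2)) := by
  have := det3_mul_det3 (p i) (p j) (p k) v
  rw [inner_self_of_unit (hunit i), inner_self_of_unit (hunit j), hi, hj, hk] at this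
  rw [edgeTerm, this]
  congr 1; ring

/-- On the line of the edge, the k-th inequality bounds the position det(p_i, p_j, ·) on one side,
with equality at v. -/
lemma det3_mul_sub_nonneg (hunit : ∀ i, ‖p i‖ = 1) (hc : (inner ℝ (p i) (p j) : ℝ) ^ 2 < 1)
    {v x : E3} (hi : inner ℝ v (p i) = h i)
    (hj : inner ℝ v (p j) = h j) (hk : inner ℝ v (p k) = h k)
    (hx : x ∈ polyFace p h i ∩ polyFace p h j) :
    0 ≤ (det3 (p i) (p j) v - det3 (p i) (p j) x) * det3 (p i) (p j) (p k) := by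
  have h1 := det3_mul_det3 (p i) (p j) (p k) v
  have h2 := det3_mul_det3 (p i) (p j) (p k) x
  rw [inner_self_of_unit (hunit i), inner_self_of_unit (hunit j), hi, hj, hk] at h1
  rw [inner_self_of_unit (hunit i), inner_self_of_unit (hunit j), hx.1.2, hx.2.2] at h2
  rw [sub_mul, h1, h2]
  have h3 := mul_nonneg (sub_nonneg.2 hc.le) (sub_nonneg.2 (hx.1.1 k))
  linarith

lemma sub_eq_smul_cross3 (hunit : ∀ i, ‖p i‖ = 1) {x y : E3}
    (hx : x ∈ polyFace p h i ∩ polyFace p h j) (hy : y ∈ polyFace p h i ∩ polyFace p h j) :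
    (1 - (inner ℝ (p i) (p j) : ℝ) ^ 2) • (x - y)
      = (det3 (p i) (p j) x - det3 (p i) (p j) y) • cross3 (p i) (p j) := by
  have := smul_eq_det3_smul_cross3 (u := p i) (v := p j) (w := x - y)
    (by rw [inner_sub_left, hx.1.2, hy.1.2, sub_self])
    (by rw [inner_sub_left, hx.2.2, hy.2.2, sub_self])
  rwa [inner_self_of_unit (hunit i), inner_self_of_unit (hunit j), mul_one, det3_sub_right] at this

lemma convex_polyFace (p : Fin n → E3) (h : Fin n → ℝ) (i : Fin n) :
    Convex ℝ (polyFace p h i) := by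
  intro x hx y hy r s hr hs hrs
  refine ⟨fun k => ?_, ?_⟩
  · rw [inner_add_left, inner_smul_left, inner_smul_left, ← one_mul (h k), ← hrs, add_mul]
    exact add_le_add (mul_le_mul_of_nonneg_left (hx.1 k) hr)
      (mul_le_mul_of_nonneg_left (hy.1 k) hs)
  · rw [inner_add_left, inner_smul_left, inner_smul_left, hx.2, hy.2, conj_trivial, conj_trivial,
      ← add_mul, hrs, one_mul]

/-- The intersection of two faces is the segment between the vertices dual to the two triangles at
the corresponding edge of the triangulation. -/
lemma polyFace_inter_eq_segment (hunit : ∀ i, ‖p i‖ = 1)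
    (hDk : 0 < det3 (p i) (p j) (p k)) (hDl : det3 (p i) (p j) (p l) < 0) {v w : E3}
    (hv : v ∈ polyFace p h i ∩ polyFace p h j) (hvk : inner ℝ v (p k) = h k)
    (hw : w ∈ polyFace p h i ∩ polyFace p h j) (hwl : inner ℝ w (p l) = h l) :
    polyFace p h i ∩ polyFace p h j = segment ℝ v w := by
  have hc := inner_sq_lt_one_of_det3_ne_zero (hunit i) (hunit j) hDk.ne'
  have hc' := (sub_pos.2 hc).ne'
  apply Set.Subset.antisymm
  · intro x hx
    have h1 : det3 (p i) (p j) x ≤ det3 (p i) (p j) v :=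
      sub_nonneg.1 (nonneg_of_mul_nonneg_left
        (det3_mul_sub_nonneg hunit hc hv.1.2 hv.2.2 hvk hx) hDk)
    have h2 : det3 (p i) (p j) w ≤ det3 (p i) (p j) x := by
      have := det3_mul_sub_nonneg hunit hc hw.1.2 hw.2.2 hwl hx
      nlinarith
    have e1 := sub_eq_smul_cross3 hunit hx hw
    have e2 := sub_eq_smul_cross3 hunit hv hw
    -- The endpoints coincide when, for instance, ij is a diagonal of a cell; the parameter θ exists
    -- only otherwise.
    rcases (h2.trans h1).eq_or_lt with he | hlt
    · have : det3 (p i) (p j) x - det3 (p i) (p j) w = 0 := by linarith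
      rw [this, zero_smul, smul_eq_zero] at e1
      rw [sub_eq_zero.1 (e1.resolve_left hc')]
      exact right_mem_segment ℝ v w
    · set θ := (det3 (p i) (p j) x - det3 (p i) (p j) w)
        / (det3 (p i) (p j) v - det3 (p i) (p j) w) with hθ
      have hlt' := sub_pos.2 hlt
      refine ⟨θ, 1 - θ, div_nonneg (by linarith) hlt'.le,
        sub_nonneg.2 ((div_le_one hlt').2 (by linarith)), by ring, ?_⟩
      have e3 : x - w = θ • (v - w) := by
        have : (1 - (inner ℝ (p i) (p j) : ℝ) ^ 2) • (x - w)
            = (1 - (inner ℝ (p i) (p j) : ℝ) ^ 2) • (θ • (v - w)) := by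
          rw [e1, smul_comm, e2, smul_smul, hθ, div_mul_cancel₀ _ hlt'.ne']
        exact smul_right_injective _ hc' this
      refine Eq.trans ?_ (sub_eq_iff_eq_add.1 e3).symm
      module
  · exact ((convex_polyFace p h i).inter (convex_polyFace p h j)).segment_subset hv hw

/-- Half base times height, with the factors sin λ cancelling. Nonnegativity is recorded because
`ENNReal.ofReal` truncates negative numbers. -/
lemma volume_coneOver_edge (hunit : ∀ i, ‖p i‖ = 1) (hji : j ≠ i) {u o : E3} (hu : ‖u‖ = 1)
    (hpu : inner ℝ (p i) u = (0 : ℝ)) (ho : IsFaceInterior p h i o)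
    (hDk : 0 < det3 (p i) (p j) (p k)) (hDl : det3 (p i) (p j) (p l) < 0) {v w : E3}
    (hv : v ∈ polyFace p h i ∩ polyFace p h j) (hvk : inner ℝ v (p k) = h k)
    (hw : w ∈ polyFace p h i ∩ polyFace p h j) (hwl : inner ℝ w (p l) = h l) :
    0 ≤ edgeTerm (p i) (p j) (p k) (h i) (h j) (h k) + edgeTerm (p i) (p j) (p l) (h i) (h j) (h l)
    ∧ volume (coneOver (affinePlaneMap (p i) u o ⁻¹' (polyFace p h i ∩ polyFace p h j)))
      = ENNReal.ofReal (1 / 2 * ((h j - inner ℝ o (p j)) *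
        (edgeTerm (p i) (p j) (p k) (h i) (h j) (h k)
          + edgeTerm (p i) (p j) (p l) (h i) (h j) (h l)))) := by
  have hc := sub_pos.2 (inner_sq_lt_one_of_det3_ne_zero (hunit i) (hunit j) hDk.ne')
  have hσ : edgeTerm (p i) (p j) (p k) (h i) (h j) (h k)
      + edgeTerm (p i) (p j) (p l) (h i) (h j) (h l)
      = (det3 (p i) (p j) v - det3 (p i) (p j) w) / (1 - inner ℝ (p i) (p j) ^ 2) := by
    rw [edgeTerm_eq_div hunit hv.1.2 hv.2.2 hvk, edgeTerm_eq_div hunit hw.1.2 hw.2.2 hwl,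
      abs_of_pos hDk, abs_of_neg hDl]
    have hDl' := hDl.ne
    field_simp
    ring
  have hle : 0 ≤ det3 (p i) (p j) v - det3 (p i) (p j) w :=
    nonneg_of_mul_nonneg_left
      (det3_mul_sub_nonneg hunit (sub_pos.1 hc) hv.1.2 hv.2.2 hvk hw) hDk
  have hσ0 : 0 ≤ (det3 (p i) (p j) v - det3 (p i) (p j) w) / (1 - inner ℝ (p i) (p j) ^ 2) :=
    div_nonneg hle hc.le
  refine ⟨hσ ▸ hσ0, ?_⟩
  obtain ⟨a, ha⟩ := exists_affinePlaneMap_eq (hunit i) hu hpu (hv.1.2.trans ho.1.symm)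
  obtain ⟨b, hb⟩ := exists_affinePlaneMap_eq (hunit i) hu hpu (hw.1.2.trans ho.1.symm)
  have hdet : a 0 * b 1 - a 1 * b 0 = -((h j - inner ℝ o (p j)) *
      ((det3 (p i) (p j) v - det3 (p i) (p j) w) / (1 - inner ℝ (p i) (p j) ^ 2))) := by
    have ea : planeMap (p i) u a = v - o := by rw [← ha, affinePlaneMap, add_sub_cancel_left]
    have eb : planeMap (p i) u b = w - o := by rw [← hb, affinePlaneMap, add_sub_cancel_left]
    rw [← det3_planeMap (hunit i) hu hpu, ea, eb]
    have e1 : w - o = (w - v) + (v - o) := by abel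
    have e2 : (1 - (inner ℝ (p i) (p j) : ℝ) ^ 2) * det3 (p i) (v - o) (w - v)
        = (det3 (p i) (p j) w - det3 (p i) (p j) v) * (h j - inner ℝ o (p j)) := by
      rw [← det3_smul_right, sub_eq_smul_cross3 hunit hw hv, det3_smul_right, det3_cross3,
        inner_self_of_unit (hunit i), inner_sub_left, inner_sub_left, hv.2.2, hv.1.2, ho.1]
      ring
    rw [e1, det3_add_right, det3_self_right, add_zero]
    field_simp
    linarith
  rw [polyFace_inter_eq_segment hunit hDk hDl hv hvk hw hwl, ← ha, ← hb,
    preimage_segment_affinePlaneMap (hunit i) hu hpu, volume_coneOver_segment, hdet,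
    abs_neg, abs_of_nonneg (mul_nonneg (sub_pos.2 (ho.2 j hji)).le hσ0), hσ]
  congr 1; ring

end Edge

/-! ### Face areas in terms of the dual triangulation. -/

section DualTriangulation

variable {n : ℕ} {p : Fin n → E3} {T : Finset (Finset (Fin n))} {h : Fin n → ℝ}

/-- The length of the edge of the polyhedron dual to the edge `ij`, divided by `sin λ_ij`. -/
def edgeSum (p : Fin n → E3) (h : Fin n → ℝ) (T : Finset (Finset (Fin n))) (i j : Fin n) : ℝ :=
  ∑ k ∈ thirdVertices T i j, edgeTerm (p i) (p j) (p k) (h i) (h j) (h k)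

lemma volume_coneOver_of_subsingleton {s : Set (EuclideanSpace ℝ (Fin 2))}
    (hs : s.Subsingleton) : volume (coneOver s) = 0 := by
  rcases hs.eq_empty_or_singleton with rfl | ⟨a, rfl⟩
  · simp [coneOver]
  · rw [← segment_same ℝ a, volume_coneOver_segment, mul_comm, sub_self]
    simp

lemma volume_coneOver_face (hunit : ∀ i, ‖p i‖ = 1) (hT : IsDualTriangulation p h T)
    {i j : Fin n} (hji : j ≠ i) {u o : E3} (hu : ‖u‖ = 1)
    (hpu : inner ℝ (p i) u = (0 : ℝ)) (ho : IsFaceInterior p h i o) :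
    0 ≤ edgeSum p h T i j ∧
    volume (coneOver (affinePlaneMap (p i) u o ⁻¹' (polyFace p h i ∩ polyFace p h j)))
      = ENNReal.ofReal (1 / 2 * ((h j - inner ℝ o (p j)) * edgeSum p h T i j)) := by
  rcases (thirdVertices T i j).eq_empty_or_nonempty with he | hne
  -- Without a triangle at ij the faces share at most one point, and the empty `edgeSum` matches the
  -- vanishing area.
  · have hsub : (polyFace p h i ∩ polyFace p h j).Subsingleton := by
      by_contra hns
      obtain ⟨t, ht, hi, hj⟩ := hT.dual_edge i j hji.symm (Set.not_subsingleton_iff.1 hns)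
      obtain ⟨k, hk, -⟩ := hT.exists_third_vertex hji.symm ht hi hj
      simp [he] at hk
    rw [volume_coneOver_of_subsingleton
      (hsub.preimage (isometry_affinePlaneMap (hunit i) hu hpu o).injective)]
    simp [edgeSum, he]
  · obtain ⟨k, l, hkl, he⟩ := hT.thirdVertices_eq_pair hne
    have hk : k ∈ thirdVertices T i j := he ▸ by simp
    have hl : l ∈ thirdVertices T i j := he ▸ by simp
    obtain ⟨v, hv⟩ := hT.in_cell _ (mem_thirdVertices.1 hk).2.2.2
    obtain ⟨w, hw⟩ := hT.in_cell _ (mem_thirdVertices.1 hl).2.2.2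
    have hvij : v ∈ polyFace p h i ∩ polyFace p h j := ⟨hv i (by simp), hv j (by simp)⟩
    have hwij : w ∈ polyFace p h i ∩ polyFace p h j := ⟨hw i (by simp), hw j (by simp)⟩
    have hvk := (hv k (by simp)).2
    have hwl := (hw l (by simp)).2
    rw [edgeSum, he, Finset.sum_pair hkl]
    rcases mul_neg_iff.1 (hT.det3_mul_det3_neg hk hl hkl) with ⟨h1, h2⟩ | ⟨h1, h2⟩
    · exact volume_coneOver_edge hunit hji hu hpu ho h1 h2 hvij hvk hwij hwl
    · rw [add_comm (edgeTerm _ _ _ _ _ _)]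
      exact volume_coneOver_edge hunit hji hu hpu ho h2 h1 hwij hwl hvij hvk

lemma measure_polyFace_eq (hunit : ∀ i, ‖p i‖ = 1)
    (hb : Bornology.IsBounded (polyhedron p h)) (hnr : Nonredundant p h)
    (hT : IsDualTriangulation p h T) {i : Fin n} {o : E3} (ho : IsFaceInterior p h i o) :
    μHE[2] (polyFace p h i) ≠ ⊤ ∧ (μHE[2] (polyFace p h i)).toReal
      = 1 / 2 * ∑ j, (h j - inner ℝ o (p j)) * edgeSum p h T i j := by
  obtain ⟨u, hu, hpu⟩ := exists_unit_orthogonal (p i)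
  have hnonneg : ∀ j : {j // j ≠ i},
      0 ≤ 1 / 2 * ((h j - inner ℝ o (p j)) * edgeSum p h T i j) := fun j =>
    mul_nonneg (by norm_num) (mul_nonneg (sub_pos.2 (ho.2 j j.2)).le
      (volume_coneOver_face hunit hT j.2 hu hpu ho).1)
  have hm : μHE[2] (polyFace p h i) = ENNReal.ofReal
      (1 / 2 * ∑ j, (h j - inner ℝ o (p j)) * edgeSum p h T i j) := by
    rw [measure_polyFace_eq_sum hunit hu hpu ho hb hnr,
      Finset.sum_congr rfl fun j _ => (volume_coneOver_face hunit hT j.2 hu hpu ho).2,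
      ← ENNReal.ofReal_sum_of_nonneg fun j _ => hnonneg j, ← Finset.mul_sum]
    congr 2
    -- The index j = i contributes nothing because `o` lies on the i-th plane, so the sum may run
    -- over all j.
    have hi : (h i - inner ℝ o (p i)) * edgeSum p h T i i = 0 := by rw [ho.1, sub_self, zero_mul]
    rw [← Fintype.sum_subtype_add_sum_subtype (fun j => j ≠ i)
      fun j => (h j - inner ℝ o (p j)) * edgeSum p h T i j]
    exact (add_eq_left.2 (Finset.sum_eq_zero fun x _ => by rw [not_not.1 x.2, hi])).symm
  refine ⟨hm ▸ ENNReal.ofReal_ne_top, ?_⟩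
  rw [hm, ENNReal.toReal_ofReal]
  refine mul_nonneg (by norm_num) (Finset.sum_nonneg fun j _ => ?_)
  rcases eq_or_ne j i with rfl | hj
  · rw [ho.1, sub_self, zero_mul]
  · exact mul_nonneg (sub_pos.2 (ho.2 j hj)).le (volume_coneOver_face hunit hT hj hu hpu ho).1

/-- The outward normals of the edges of a face, weighted with the lengths, add up to zero. -/
lemma sum_edgeSum_mul_inner_eq_zero (hunit : ∀ i, ‖p i‖ = 1)
    (hb : Bornology.IsBounded (polyhedron p h)) (hnr : Nonredundant p h)
    (hT : IsDualTriangulation p h T) {i : Fin n} {o : E3} (ho : IsFaceInterior p h i o) {w : E3}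
    (hw : inner ℝ w (p i) = (0 : ℝ)) : ∑ j, inner ℝ w (p j) * edgeSum p h T i j = 0 := by
  -- For small t the point o + t w is still relatively interior. Both points give the same area, so
  -- the linear coefficient in t vanishes.
  have hev : ∀ᶠ t : ℝ in nhds 0, ∀ j, j ≠ i → inner ℝ (o + t • w) (p j) < h j := by
    refine Filter.eventually_all.2 fun j => ?_
    by_cases hj : j = i
    · exact Filter.Eventually.of_forall fun t hj' => absurd hj hj'
    · have hc : Continuous fun t : ℝ => (inner ℝ (o + t • w) (p j) : ℝ) := by fun_prop
      filter_upwards [(hc.tendsto 0).eventually_lt_const (u := h j)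
        (by simpa using ho.2 j hj)] with t ht _ using ht
  obtain ⟨t, ht, ht0⟩ := ((hev.filter_mono nhdsWithin_le_nhds).and
    (self_mem_nhdsWithin (s := Set.Ioi (0 : ℝ)))).exists
  have ho' : IsFaceInterior p h i (o + t • w) :=
    ⟨by rw [inner_add_left, inner_smul_left, hw, mul_zero, add_zero, ho.1], ht⟩
  have e1 := (measure_polyFace_eq hunit hb hnr hT ho).2
  have e2 := (measure_polyFace_eq hunit hb hnr hT ho').2
  have e3 : ∑ j, (h j - inner ℝ (o + t • w) (p j)) * edgeSum p h T i j
      = ∑ j, (h j - inner ℝ o (p j)) * edgeSum p h T i j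
        - t * ∑ j, inner ℝ w (p j) * edgeSum p h T i j := by
    rw [Finset.mul_sum, ← Finset.sum_sub_distrib]
    refine Finset.sum_congr rfl fun j _ => ?_
    rw [inner_add_left, inner_smul_left, conj_trivial]; ring
  have h0 : t * ∑ j, inner ℝ w (p j) * edgeSum p h T i j = 0 := by linarith
  exact (mul_eq_zero.1 h0).resolve_left (ne_of_gt ht0)

/-- The base point moves to h_i p_i, the foot of the perpendicular from the origin;
`sum_edgeSum_mul_inner_eq_zero` removes the difference. This turns the slack into h_j - ⟨p_i, p_j⟩
h_i, the factor in `areaTerm`. -/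
lemma toReal_measure_polyFace (hunit : ∀ i, ‖p i‖ = 1)
    (hb : Bornology.IsBounded (polyhedron p h)) (hnr : Nonredundant p h)
    (hT : IsDualTriangulation p h T) {i : Fin n} {o : E3} (ho : IsFaceInterior p h i o) :
    (μHE[2] (polyFace p h i)).toReal = 1 / 2 * ∑ j, ∑ k ∈ thirdVertices T i j,
      areaTerm (p i) (p j) (p k) (h i) (h j) (h k) := by
  have h0 := sum_edgeSum_mul_inner_eq_zero hunit hb hnr hT ho (w := o - h i • p i)
    (by rw [inner_sub_left, inner_smul_left, inner_self_of_unit (hunit i), ho.1]; simp)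
  have e : ∑ j, ∑ k ∈ thirdVertices T i j, areaTerm (p i) (p j) (p k) (h i) (h j) (h k)
      = ∑ j, (h j - inner ℝ o (p j)) * edgeSum p h T i j
        + ∑ j, inner ℝ (o - h i • p i) (p j) * edgeSum p h T i j := by
    rw [← Finset.sum_add_distrib]
    refine Finset.sum_congr rfl fun j _ => ?_
    simp only [areaTerm]
    rw [← Finset.mul_sum, ← edgeSum, inner_sub_left, inner_smul_left, conj_trivial]
    ring
  rw [(measure_polyFace_eq hunit hb hnr hT ho).2, e, h0, add_zero]

end DualTriangulation

end

theorem mainTheorem1 (n : ℕ) (p : Fin n → E3) (h : Fin n → ℝ)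
    (hunit : ∀ i, ‖p i‖ = 1)
    (hbounded : Bornology.IsBounded (polyhedron p h))
    (hsolid : (interior (polyhedron p h)).Nonempty)
    (hnonredundant : Nonredundant p h)
    (T : Finset (Finset (Fin n))) (hT : IsDualTriangulation p h T) :
    ((∀ i, vertexWeight p T i ≠ 0) →
      surfaceArea (polyhedron p h)
        = 1 / 2 * dInner (vertexWeight p T) h (2 • h + sphLaplacian p T h)) ∧
    surfaceArea (polyhedron p h)
      = 1 / 2 * (2 * dInner (vertexWeight p T) h h + weakSphLaplacian p T h h) := by
  have key : surfaceArea (polyhedron p h)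
      = 1 / 2 * (2 * dInner (vertexWeight p T) h h + weakSphLaplacian p T h h) := by
    choose o ho using exists_isFaceInterior hunit hsolid hnonredundant
    rw [surfaceArea_eq_sum hunit hsolid hnonredundant
        fun i => (measure_polyFace_eq hunit hbounded hnonredundant hT (ho i)).1,
      Finset.sum_congr rfl fun i _ =>
        toReal_measure_polyFace hunit hbounded hnonredundant hT (ho i),
      ← Finset.mul_sum, sum_areaTerm_eq_sum_weightTerm hunit hT.toIsSphereTriangulation,
      weight_form_eq_sum hunit hT.toIsSphereTriangulation]
  exact ⟨fun hd => by rw [key, dInner_sphLaplacian hd], key⟩
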